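/- **Setting.** A datacenter has $m\ge 1$ resources with capacities $C_i>0$ and $n$ users. A job of user $j$ requires $R_{ij}\ge 0$ of resource $i$, and every user requires a positive amount of some resource. User $j$ has the isoelastic utility $U_j(x)=\frac{c_j}{1-\alpha_j}x^{1-\alpha_j}$ with $c_j>0$, $\alpha_j\in(0,1)$; the volume discount is $\gamma\in(0,1]$ with $\gamma>1-\alpha_j$ for all $j$. At a per-job cost $r>0$ user $j$ demands the number of jobs $x_j^\star(r)\ge 0$ that maximizes $U_j(x)-r x^\gamma$ over $x\ge 0$. Consider any of the three pricing plans: * resource pricing: prices ${\bf p}\in\mathbb R^m$, $r_j({\bf p})=\sum_i p_iR_{ij}^\gamma$, constraints $\sum_j R_{ij}x_j^\star(r_j({\bf p}))\le C_i$ for $i=1,\dots,m$; * bundled pricing with a fixed bundle $b_1,\dots,b_m>0$: a price $p\in\mathbb R$, $r_j(p)=\mu_j^\gamma p$ where $\mu_j=\max_i R_{ij}/b_i$, and the single constraint $\sum_j\mu_jx_j^\star(r_j(p))\le\min_iC_i/b_i$; * differentiated pricing: prices ${\bf p}\in\mathbb R^n$, $r_j({\bf p})=p_j$, constraints $\sum_j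 R_{ij}x_j^\star(r_j({\bf p}))\le C_i$ for $i=1,\dots,m$. Write the constraints as $g_i({\bf p})\le D_i$, $i=1,\dots,K$. Prices are feasible if $r_j({\bf p})>0$ for all $j$ and all constraints hold, and strictly feasible if moreover $g_i({\bf p})<D_i$ for all $i$. Let $x_j^\star=x_j^\star(r_j({\bf p}))$, $r_j=r_j({\bf p})$ and $$\rho({\bf p})=\sum_j r_j\,(x_j^\star)^\gamma,\qquad \overline U_j=U_j(x_j^\star)-r_j\,(x_j^\star)^\gamma,\qquad F_\beta({\bf p})=\frac1{1-\beta}\sum_j\overline U_j^{\,1-\beta},$$ where $\beta>0$, $\beta\ne1$. Let $\nu>0$, and let $M$ be the set of maximizers of $\nu\rho+F_\beta$ over the feasible prices. **Algorithm.** Given a tolerance $\mathrm{tol}>0$, an update parameter $\mu>1$ and initial prices, start with $t=1$. While $t<K/\mathrm{tol}$: among the strictly feasible solutions ${\bf p}$ of $\nabla f_t({\bf p})=0$, where $$f_t({\bf p})=-t\,\nu\rho({\bf p})-t\,F_\beta({\bf p})-\sum_{i=1}^K\log\bigl(D_i-g_i({\bf p})\bigr),$$ take one with the least value of $f_t$ as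 the new prices (ties are broken arbitrarily), and replace $t$ by $\mu t$. When the loop ends, return the current prices. **Theorem.** For each of the three pricing plans the algorithm converges to prices that maximize $\nu\rho+F_\beta$, in the following sense. 1. $M$ is non-empty, and for every $t>0$ there is a strictly feasible solution of $\nabla f_t=0$ with the least value of $f_t$ among all such solutions, so every step can be carried out. For every $\mathrm{tol}>0$ there is no infinite run. 2. For every $\varepsilon>0$ there is $\delta>0$ such that, for all $0<\mathrm{tol}<\delta$, all initial prices and all choices in the steps, the returned prices are strictly feasible, lie at distance less than $\varepsilon$ from some point of $M$, and have an objective value greater than $\max(\nu\rho+F_\beta)-\varepsilon$. 3. Let ${\bf p}^{(0)},{\bf p}^{(1)},\dots$ be any iterates of the loop without its stopping rule, i.e. ${\bf p}^{(s)}$ is chosen as above for $t=\mu^s$. Then the distance of ${\bf p}^{(s)}$ to $M$ tends to $0$, the objective values converge to the maximum, every cluster point of the iterates belongs to $M$, and if $M=\{{\bf p}^\star\}$ then ${\bf p}^{(s)}\to{\bf p}^\star$. -/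

import Mathlib

/-! ### Users -/

/-- Isoelastic utility `U(x) = c (1 - α)⁻¹ x ^ (1 - α)` for `α ∈ (0, 1)`; in particular
`U(0) = 0`. -/
noncomputable def isoelasticUtility (c α x : ℝ) : ℝ := c / (1 - α) * x ^ (1 - α)

/-- The net utility `U(x) - r x ^ γ` of a user who submits `x` jobs at per-job cost `r` under the
volume discount `γ`. -/
noncomputable def netUtility (c α γ r x : ℝ) : ℝ := isoelasticUtility c α x - r * x ^ γ

/-- `x` is a number of jobs that maximizes the net utility over all `y ≥ 0`. -/
def IsDemand (c α γ r x : ℝ) : Prop :=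
  0 ≤ x ∧ ∀ y, 0 ≤ y → netUtility c α γ r y ≤ netUtility c α γ r x

open Classical in
/-- The demand `x⋆(r)`: the utility-maximizing number of jobs at per-job cost `r`. It exists and
is unique for `r > 0` (`existsUnique_isDemand`); for `r ≤ 0` the net utility is unbounded above,
and only costs `r > 0` are ever admitted below. -/
noncomputable def demand (c α γ r : ℝ) : ℝ :=
  if h : ∃ x, IsDemand c α γ r x then h.choose else 0

theorem demand_nonneg (c α γ r : ℝ) : 0 ≤ demand c α γ r := by
  unfold demand
  split_ifs with h
  · exact h.choose_spec.1
  · exact le_rfl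

theorem isDemand_iff {c α γ r : ℝ} (hc : 0 < c) (hα1 : α < 1) (hγ : 1 - α < γ)
    (hr : 0 < r) (x : ℝ) :
    IsDemand c α γ r x ↔ x = (c / (γ * r)) ^ (1 / (γ + α - 1)) := by
  have hγ0 : 0 < γ := by linarith
  have ha : 0 < γ + α - 1 := by linarith
  have h1a : 0 < 1 - α := by linarith
  set x0 : ℝ := (c / (γ * r)) ^ (1 / (γ + α - 1)) with hx0
  have hq : 0 < c / (γ * r) := by positivity
  have hx0pos : 0 < x0 := Real.rpow_pos_of_pos hq _
  have hfoc : c * x0 ^ (1 - α) = r * γ * x0 ^ γ := by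
    have h1 : x0 ^ (γ + α - 1) = c / (γ * r) := by
      rw [hx0, ← Real.rpow_mul hq.le, one_div_mul_cancel ha.ne', Real.rpow_one]
    have h2 : x0 ^ γ = x0 ^ (γ + α - 1) * x0 ^ (1 - α) := by
      rw [← Real.rpow_add hx0pos]; congr 1; ring
    rw [h2, h1]; field_simp
  have hθ0 : 0 < (1 - α) / γ := by positivity
  have hθ1 : (1 - α) / γ < 1 := (div_lt_one hγ0).2 hγ
  have hpay : ∀ y, 0 ≤ y → netUtility c α γ r y =
      r * x0 ^ γ * (γ / (1 - α)) *
        (((y / x0) ^ γ) ^ ((1 - α) / γ) - (1 - α) / γ * (y / x0) ^ γ) := by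
    intro y hy
    have hz : 0 ≤ y / x0 := by positivity
    have hyx : y = x0 * (y / x0) := by field_simp
    have e1 : ((y / x0) ^ γ) ^ ((1 - α) / γ) = (y / x0) ^ (1 - α) := by
      rw [← Real.rpow_mul hz]; congr 1; field_simp
    rw [e1]
    unfold netUtility isoelasticUtility
    conv_lhs => rw [hyx]
    rw [Real.mul_rpow hx0pos.le hz, Real.mul_rpow hx0pos.le hz]
    have : c / (1 - α) * (x0 ^ (1 - α) * (y / x0) ^ (1 - α)) =
        (c * x0 ^ (1 - α)) / (1 - α) * (y / x0) ^ (1 - α) := by ring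
    rw [this, hfoc]; field_simp
  have hK : 0 < r * x0 ^ γ * (γ / (1 - α)) := by positivity
  have hself : netUtility c α γ r x0 = r * x0 ^ γ * (γ / (1 - α)) * (1 - (1 - α) / γ) := by
    rw [hpay x0 hx0pos.le, div_self hx0pos.ne']; simp
  have hlt : ∀ y, 0 ≤ y → y ≠ x0 → netUtility c α γ r y < netUtility c α γ r x0 := by
    intro y hy hne
    rw [hself, hpay y hy]
    refine mul_lt_mul_of_pos_left ?_ hK
    have hu : 0 ≤ (y / x0) ^ γ := Real.rpow_nonneg (by positivity) _
    have hu1 : (y / x0) ^ γ - 1 ≠ 0 := by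
      intro h
      have h' : (y / x0) ^ γ = (1 : ℝ) ^ γ := by rw [Real.one_rpow]; linarith
      have := (Real.rpow_left_inj (by positivity) zero_le_one hγ0.ne').1 h'
      exact hne ((div_eq_one_iff_eq hx0pos.ne').1 this)
    have := rpow_one_add_lt_one_add_mul_self (s := (y / x0) ^ γ - 1) (by linarith) hu1
      hθ0 hθ1
    rw [add_sub_cancel] at this
    linarith
  constructor
  · rintro ⟨hx, hmax⟩
    by_contra hne
    exact absurd (hmax x0 hx0pos.le) (not_le.2 (hlt x hx hne))
  · rintro rfl
    refine ⟨hx0pos.le, fun y hy => ?_⟩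
    by_cases h : y = x0
    · rw [h]
    · exact (hlt y hy h).le

theorem existsUnique_isDemand {c α γ r : ℝ} (hc : 0 < c) (hα1 : α < 1) (hγ : 1 - α < γ)
    (hr : 0 < r) : ∃! x, IsDemand c α γ r x :=
  ⟨_, (isDemand_iff hc hα1 hγ hr _).2 rfl, fun _ h => (isDemand_iff hc hα1 hγ hr _).1 h⟩

/-! ### The operator's problem -/

/-- A pricing problem with `d` price variables, `k` capacity constraints and `n` users with
isoelastic utilities. User `j` pays the per-job cost `r_j(p) = ∑ l, cost j l * p l`, and the
constraints are `∑ j, usage i j * x_j⋆(r_j(p)) ≤ cap i`. -/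
structure PricingProblem (d k n : ℕ) where
  c : Fin n → ℝ
  α : Fin n → ℝ
  γ : ℝ
  cost : Fin n → Fin d → ℝ
  usage : Fin k → Fin n → ℝ
  cap : Fin k → ℝ

namespace PricingProblem

variable {d k n : ℕ} (P : PricingProblem d k n)

/-- The per-job cost `r_j(p)`. -/
noncomputable def jobCost (p : Fin d → ℝ) (j : Fin n) : ℝ := ∑ l, P.cost j l * p l

/-- The demand `x_j⋆(r_j(p))`. -/
noncomputable def jobs (p : Fin d → ℝ) (j : Fin n) : ℝ :=
  demand (P.c j) (P.α j) P.γ (P.jobCost p j)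

/-- The revenue `ρ(p) = ∑ j, r_j x_j⋆ ^ γ`, the sum of the users' payments. -/
noncomputable def revenue (p : Fin d → ℝ) : ℝ := ∑ j, P.jobCost p j * P.jobs p j ^ P.γ

/-- The net utility `U_j(x_j⋆) - r_j x_j⋆ ^ γ` that user `j` receives. -/
noncomputable def received (p : Fin d → ℝ) (j : Fin n) : ℝ :=
  netUtility (P.c j) (P.α j) P.γ (P.jobCost p j) (P.jobs p j)

/-- The fairness `F_β(p)` of the net utilities received. -/
noncomputable def fairness (β : ℝ) (p : Fin d → ℝ) : ℝ :=
  1 / (1 - β) * ∑ j, P.received p j ^ (1 - β)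

/-- The objective `ν ρ(p) + F_β(p)`. -/
noncomputable def objective (ν β : ℝ) (p : Fin d → ℝ) : ℝ :=
  ν * P.revenue p + P.fairness β p

/-- The amount `∑ j, usage i j * x_j⋆` used of the `i`-th capacity. -/
noncomputable def load (p : Fin d → ℝ) (i : Fin k) : ℝ := ∑ j, P.usage i j * P.jobs p j

/-- Feasible prices: every user's demand is defined, i.e. her per-job cost is positive, and the
capacity constraints hold. -/
def feasible : Set (Fin d → ℝ) :=
  {p | (∀ j, 0 < P.jobCost p j) ∧ ∀ i, P.load p i ≤ P.cap i}

/-- Strictly feasible prices, the domain of the logarithmic barrier. -/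
def strictlyFeasible : Set (Fin d → ℝ) :=
  {p | (∀ j, 0 < P.jobCost p j) ∧ ∀ i, P.load p i < P.cap i}

/-- The prices that maximize `ν ρ + F_β` over the feasible prices. -/
def maximizers (ν β : ℝ) : Set (Fin d → ℝ) :=
  {p | p ∈ P.feasible ∧ ∀ q ∈ P.feasible, P.objective ν β q ≤ P.objective ν β p}

/-! ### The interior-point algorithm -/

/-- `f_t(p) = -t ν ρ(p) - t F_β(p) - ∑ i, log (cap i - load i)`. -/
noncomputable def barrier (ν β t : ℝ) (p : Fin d → ℝ) : ℝ :=
  -t * ν * P.revenue p - t * P.fairness β p - ∑ i, Real.log (P.cap i - P.load p i)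

/-- The solutions `p` of `∇ f_t(p) = 0`. -/
def stationary (ν β t : ℝ) : Set (Fin d → ℝ) :=
  {p | p ∈ P.strictlyFeasible ∧
    HasFDerivAt (P.barrier ν β t) (0 : (Fin d → ℝ) →L[ℝ] ℝ) p}

/-- The possible results of one pass through the loop: those solutions of `∇ f_t(p) = 0` that have
the least value of `f_t` among all solutions. -/
def candidates (ν β t : ℝ) : Set (Fin d → ℝ) :=
  {p | p ∈ P.stationary ν β t ∧
    ∀ q ∈ P.stationary ν β t, P.barrier ν β t p ≤ P.barrier ν β t q}

/-- One pass through the `while` loop, from the state `(t, p)` to the state `(t', p')`: if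
`t < k / tol`, replace `p` by a candidate for `t`, and then `t` by `μ t`. -/
def Step (ν β μ tol : ℝ) (s s' : ℝ × (Fin d → ℝ)) : Prop :=
  s.1 < k / tol ∧ s'.2 ∈ P.candidates ν β s.1 ∧ s'.1 = μ * s.1

/-- `p` is returned by some run of the algorithm: the loop, entered with `t = 1` and the prices
`p₀`, can reach a state with prices `p` in which the loop condition fails. -/
def Returns (ν β μ tol : ℝ) (p₀ p : Fin d → ℝ) : Prop :=
  ∃ t : ℝ, Relation.ReflTransGen (P.Step ν β μ tol) (1, p₀) (t, p) ∧ ¬ t < k / tol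

/-- Convergence of the algorithm to the prices that maximize `ν ρ + F_β`. -/
structure InteriorPointConverges (ν β μ : ℝ) : Prop where
  /-- The objective has a maximum over the feasible prices. -/
  exists_maximizer : (P.maximizers ν β).Nonempty
  /-- Each pass through the loop can be carried out. -/
  exists_candidate : ∀ t : ℝ, 0 < t → (P.candidates ν β t).Nonempty
  /-- There is no infinite run. -/
  terminates : ∀ tol : ℝ, 0 < tol → ∀ p₀ : Fin d → ℝ,
    Acc (fun s' s => P.Step ν β μ tol s s') (1, p₀)
  /-- Whatever choices are made among the candidates, the returned prices are strictly feasible,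
  and as `tol → 0` they approach the set of maximizers, and their objective value approaches the
  maximum. -/
  returned : ∀ ε : ℝ, 0 < ε → ∃ δ : ℝ, 0 < δ ∧ ∀ tol : ℝ, 0 < tol → tol < δ →
    ∀ p₀ p : Fin d → ℝ, P.Returns ν β μ tol p₀ p →
      p ∈ P.strictlyFeasible ∧
      (∃ q ∈ P.maximizers ν β, dist p q < ε) ∧
      ∀ q ∈ P.maximizers ν β, P.objective ν β q - ε < P.objective ν β p
  /-- Without the stopping rule, every sequence of iterates approaches the set of maximizers, its
  objective values converge to the maximum, all its cluster points are maximizers, and it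
  converges to the maximizer if there is only one. -/
  iterates : ∀ p : ℕ → Fin d → ℝ, (∀ s, p s ∈ P.candidates ν β (μ ^ s)) →
    Filter.Tendsto (fun s => Metric.infDist (p s) (P.maximizers ν β)) Filter.atTop (nhds 0) ∧
    (∀ q ∈ P.maximizers ν β, Filter.Tendsto (fun s => P.objective ν β (p s)) Filter.atTop
      (nhds (P.objective ν β q))) ∧
    (∀ q, MapClusterPt q Filter.atTop p → q ∈ P.maximizers ν β) ∧
    (∀ q, P.maximizers ν β = {q} → Filter.Tendsto p Filter.atTop (nhds q))

end PricingProblem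

/-! ### Datacenters and the three pricing plans -/

/-- A datacenter with `m` resources and `n` users: requirements `R i j` of resource `i` per job of
user `j`, capacities `C i`, the parameters `c j`, `α j` of the utility of user `j`, and the volume
discount `γ`. -/
structure Datacenter (m n : ℕ) where
  R : Fin m → Fin n → ℝ
  C : Fin m → ℝ
  c : Fin n → ℝ
  α : Fin n → ℝ
  γ : ℝ
  R_nonneg : ∀ i j, 0 ≤ R i j
  exists_R_pos : ∀ j, ∃ i, 0 < R i j
  C_pos : ∀ i, 0 < C i
  c_pos : ∀ j, 0 < c j
  α_pos : ∀ j, 0 < α j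
  α_lt_one : ∀ j, α j < 1
  γ_pos : 0 < γ
  γ_le_one : γ ≤ 1
  one_sub_α_lt_γ : ∀ j, 1 - α j < γ

namespace Datacenter

variable {m n : ℕ} (D : Datacenter m n)

/-- Resource pricing: one unit price per resource, `r_j = ∑ i, p_i R_ij ^ γ`. -/
noncomputable def resourcePricing : PricingProblem m m n where
  c := D.c
  α := D.α
  γ := D.γ
  cost := fun j i => D.R i j ^ D.γ
  usage := D.R
  cap := D.C

/-- The number `max_i (R_ij / b_i)` of bundles that one job of user `j` needs. -/
noncomputable def bundlesPerJob (b : Fin m → ℝ) (j : Fin n) : ℝ := ⨆ i, D.R i j / b i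

/-- Bundled pricing: one price per bundle `b`, `r_j = p (max_i (R_ij / b_i)) ^ γ`, and the single
constraint that at most `min_i (C_i / b_i)` bundles are sold. -/
noncomputable def bundledPricing (b : Fin m → ℝ) : PricingProblem 1 1 n where
  c := D.c
  α := D.α
  γ := D.γ
  cost := fun j _ => D.bundlesPerJob b j ^ D.γ
  usage := fun _ j => D.bundlesPerJob b j
  cap := fun _ => ⨅ i, D.C i / b i

/-- Differentiated pricing: one per-job price for each user, `r_j = p_j`. -/
noncomputable def differentiatedPricing : PricingProblem n m n where
  c := D.c
  α := D.α
  γ := D.γ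
  cost := fun j l => if l = j then 1 else 0
  usage := D.R
  cap := D.C

/-- The revenue under resource pricing is `∑ i, p_i ∑ j, (R_ij x_j⋆) ^ γ`. -/
theorem resourcePricing_revenue (p : Fin m → ℝ) :
    D.resourcePricing.revenue p =
      ∑ i, p i * ∑ j, (D.R i j * D.resourcePricing.jobs p j) ^ D.γ := by
  simp only [PricingProblem.revenue, PricingProblem.jobCost, Finset.sum_mul, Finset.mul_sum]
  rw [Finset.sum_comm]
  refine Finset.sum_congr rfl fun i _ => Finset.sum_congr rfl fun j _ => ?_
  have hx : 0 ≤ D.resourcePricing.jobs p j := demand_nonneg _ _ _ _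
  rw [Real.mul_rpow (D.R_nonneg i j) hx]
  simp only [resourcePricing]
  ring

/-- The revenue under bundled pricing is `p ∑ j, (μ_j x_j⋆) ^ γ` with `μ_j` bundles per job. -/
theorem bundledPricing_revenue (b : Fin m → ℝ) (hb : ∀ i, 0 < b i) (p : Fin 1 → ℝ) :
    (D.bundledPricing b).revenue p =
      p 0 * ∑ j, (D.bundlesPerJob b j * (D.bundledPricing b).jobs p j) ^ D.γ := by
  simp only [PricingProblem.revenue, PricingProblem.jobCost, Finset.mul_sum]
  refine Finset.sum_congr rfl fun j _ => ?_
  have h : 0 ≤ D.bundlesPerJob b j :=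
    Real.iSup_nonneg fun i => div_nonneg (D.R_nonneg i j) (hb i).le
  have hx : 0 ≤ (D.bundledPricing b).jobs p j := demand_nonneg _ _ _ _
  rw [Real.mul_rpow h hx, Fin.sum_univ_one]
  simp only [bundledPricing]
  ring

/-- The revenue under differentiated pricing is `∑ j, p_j x_j⋆ ^ γ`. -/
theorem differentiatedPricing_revenue (p : Fin n → ℝ) :
    D.differentiatedPricing.revenue p =
      ∑ j, p j * demand (D.c j) (D.α j) D.γ (p j) ^ D.γ := by
  simp [PricingProblem.revenue, PricingProblem.jobs, PricingProblem.jobCost, differentiatedPricing]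

end Datacenter

/-! At the optimal demand everything is a power of the per-job cost `r`: the demand is `A r^(-s)`,
and a user adds `W r^(-κ) + V/(1-β) r^(-κ(1-β))` to the objective, with `κ < s` because `α > 0`
(`IsUser.exists_powers`).

Concavity plays no role. The barrier function attains a global minimum over the open set of strictly
feasible prices, so the stationary points of least value are exactly the global minimizers
(`mem_candidates_iff`). Comparing such a minimizer with one fixed strictly feasible point close to a
maximizer, and dividing by `t`, shows that the objective values tend to the maximum
(`exists_objective_gt`).

The difficulty is the lack of compactness. Capacities keep the costs away from `0`, but costs may
tend to `+∞`, and prices may drift along the kernel of the map from prices to costs. Drift is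
harmless: a generalized inverse moves the prices by a vanishing amount onto the limiting costs
(`exists_lift`). Diverging costs send the objective to `-∞` if `β > 1`. If `β < 1`, the users
concerned lose both demand and value in the limit, but their value decays more slowly than their
demand. Readmitting them at a large finite cost therefore gains more than is lost by making room for
them, whether by raising all prices (`exists_feasible_gt`) or by spending logarithmic slack
(`exists_strictlyFeasible_lt`). So an optimizing ultrafilter leaves no user at infinity. This gives
maximizers and barrier minimizers, and puts almost optimal prices close to the maximizers
(`exists_near_maximizers`). -/

open Filter Topology

/-! ### Demand and value of a single user -/

/-- The admissible parameters of a user. -/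
structure IsUser (c α γ : ℝ) : Prop where
  c_pos : 0 < c
  α_pos : 0 < α
  α_lt_one : α < 1
  one_sub_lt : 1 - α < γ

/-- The contribution of a user with per-job cost `r` to the objective `ν ρ + F_β`. -/
noncomputable def userValue (c α γ ν β r : ℝ) : ℝ :=
  ν * (r * demand c α γ r ^ γ) +
    1 / (1 - β) * netUtility c α γ r (demand c α γ r) ^ (1 - β)

namespace IsUser

variable {c α γ : ℝ}

theorem demand_eq (h : IsUser c α γ) {r : ℝ} (hr : 0 < r) :
    demand c α γ r = (c / (γ * r)) ^ (1 / (γ + α - 1)) := by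
  have hex := (existsUnique_isDemand h.c_pos h.α_lt_one h.one_sub_lt hr).exists
  have : IsDemand c α γ r (demand c α γ r) := by
    unfold demand
    rw [dif_pos hex]
    exact hex.choose_spec
  exact (isDemand_iff h.c_pos h.α_lt_one h.one_sub_lt hr _).1 this

/-- The closed form of the demand turns payment and net utility into multiples of the same power
`r^(-κ)`. The strict inequality `κ < s` is what later makes value outweigh demand at high cost. -/
theorem exists_powers (h : IsUser c α γ) {ν : ℝ} (hν : 0 < ν) (β : ℝ) :
    ∃ A s W V κ : ℝ, 0 < A ∧ 0 < s ∧ 0 < W ∧ 0 < V ∧ 0 < κ ∧ κ < s ∧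
      (∀ r, 0 < r → demand c α γ r = A * r ^ (-s)) ∧
      ∀ r, 0 < r → userValue c α γ ν β r =
        W * r ^ (-κ) + V / (1 - β) * r ^ (-(κ * (1 - β))) := by
  obtain ⟨hc, hα0, hα1, hγ⟩ := id h
  have hγ0 : 0 < γ := by linarith
  have ha : 0 < γ + α - 1 := by linarith
  have h1a : 0 < 1 - α := by linarith
  have hq : 0 < c / γ := by positivity
  have hθ : 0 < γ / (1 - α) - 1 := by
    rw [sub_pos, one_lt_div h1a]; exact hγ
  have hdem : ∀ r, 0 < r → demand c α γ r =
      (c / γ) ^ (1 / (γ + α - 1)) * r ^ (-(1 / (γ + α - 1))) := by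
    intro r hr
    rw [h.demand_eq hr, ← div_div, Real.div_rpow hq.le hr.le, Real.rpow_neg hr.le, div_eq_mul_inv]
  have hpay : ∀ r, 0 < r → r * demand c α γ r ^ γ =
      (c / γ) ^ (γ / (γ + α - 1)) * r ^ (-((1 - α) / (γ + α - 1))) := by
    intro r hr
    rw [hdem r hr, Real.mul_rpow (by positivity) (by positivity), ← Real.rpow_mul hq.le,
      ← Real.rpow_mul hr.le]
    have e : r ^ (-((1 - α) / (γ + α - 1))) = r * r ^ (-(1 / (γ + α - 1)) * γ) := by
      nth_rewrite 2 [← Real.rpow_one r]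
      rw [← Real.rpow_add hr]
      congr 1; field_simp; ring
    rw [e, one_div_mul_eq_div]; ring
  -- By the first-order condition `c x^(1-α) = γ r x^γ`, the utility is `γ/(1-α)` times the payment.
  have hrec : ∀ r, 0 < r → netUtility c α γ r (demand c α γ r) =
      (γ / (1 - α) - 1) * (r * demand c α γ r ^ γ) := by
    intro r hr
    have hx : 0 < demand c α γ r := by rw [h.demand_eq hr]; positivity
    have h1 : demand c α γ r ^ (γ + α - 1) = c / (γ * r) := by
      rw [h.demand_eq hr, ← Real.rpow_mul (by positivity), one_div_mul_cancel ha.ne',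
        Real.rpow_one]
    have h2 : demand c α γ r ^ γ =
        demand c α γ r ^ (γ + α - 1) * demand c α γ r ^ (1 - α) := by
      rw [← Real.rpow_add hx]; congr 1; ring
    unfold netUtility isoelasticUtility
    rw [h2, h1]
    field_simp
  refine ⟨(c / γ) ^ (1 / (γ + α - 1)), 1 / (γ + α - 1), ν * (c / γ) ^ (γ / (γ + α - 1)),
    ((γ / (1 - α) - 1) * (c / γ) ^ (γ / (γ + α - 1))) ^ (1 - β), (1 - α) / (γ + α - 1),
    by positivity, by positivity, by positivity, by positivity, by positivity, ?_, hdem, ?_⟩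
  · rw [div_lt_div_iff_of_pos_right ha]; linarith
  · intro r hr
    unfold userValue
    rw [hrec r hr, hpay r hr, ← mul_assoc (γ / (1 - α) - 1),
      Real.mul_rpow (x := (γ / (1 - α) - 1) * (c / γ) ^ (γ / (γ + α - 1))) (by positivity)
        (by positivity), ← Real.rpow_mul hr.le]
    rw [neg_mul]; ring

theorem demand_pos (h : IsUser c α γ) {r : ℝ} (hr : 0 < r) : 0 < demand c α γ r := by
  have := h.c_pos
  have : 0 < γ := by linarith [h.one_sub_lt, h.α_lt_one]
  rw [h.demand_eq hr]; positivity

theorem demand_antitone (h : IsUser c α γ) {r r' : ℝ} (hr : 0 < r) (hrr : r ≤ r') :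
    demand c α γ r' ≤ demand c α γ r := by
  -- Only the demand formula is used, so the values `ν = 1` and `β = 0` are arbitrary.
  obtain ⟨A, s, W, V, κ, hA, hs, -, -, -, -, hd, -⟩ := h.exists_powers one_pos 0
  rw [hd r hr, hd r' (hr.trans_le hrr)]
  exact mul_le_mul_of_nonneg_left
    (Real.rpow_le_rpow_of_nonpos hr hrr (by linarith)) hA.le

theorem differentiableAt_demand (h : IsUser c α γ) {r : ℝ} (hr : 0 < r) :
    DifferentiableAt ℝ (demand c α γ) r := by
  obtain ⟨A, s, W, V, κ, hA, hs, -, -, -, -, hd, -⟩ := h.exists_powers one_pos 0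
  have : DifferentiableAt ℝ (fun r : ℝ => A * r ^ (-s)) r :=
    (Real.differentiableAt_rpow_const_of_ne _ hr.ne').const_mul _
  refine this.congr_of_eventuallyEq ?_
  filter_upwards [lt_mem_nhds hr] with y hy using hd y hy

theorem tendsto_demand (h : IsUser c α γ) : Tendsto (demand c α γ) atTop (𝓝 0) := by
  obtain ⟨A, s, W, V, κ, hA, hs, -, -, -, -, hd, -⟩ := h.exists_powers one_pos 0
  have : Tendsto (fun r : ℝ => A * r ^ (-s)) atTop (𝓝 (A * 0)) :=
    (tendsto_rpow_neg_atTop hs).const_mul A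
  rw [mul_zero] at this
  refine this.congr' ?_
  filter_upwards [eventually_gt_atTop 0] with y hy using (hd y hy).symm

theorem exists_cost_lower_bound (h : IsUser c α γ) (B : ℝ) :
    ∃ r₀, 0 < r₀ ∧ ∀ r, 0 < r → demand c α γ r ≤ B → r₀ ≤ r := by
  obtain ⟨A, s, W, V, κ, hA, hs, -, -, -, -, hd, -⟩ := h.exists_powers one_pos 0
  have hb : 0 < A / (|B| + 1) := by positivity
  -- The cost at which the demand equals `|B| + 1`, which exceeds `B`.
  refine ⟨(A / (|B| + 1)) ^ (1 / s), by positivity, fun r hr hB => ?_⟩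
  by_contra hlt
  push Not at hlt
  have h1 := h.demand_antitone hr hlt.le
  rw [hd _ (by positivity), ← Real.rpow_mul hb.le, mul_neg, one_div_mul_cancel hs.ne',
    Real.rpow_neg hb.le, Real.rpow_one, inv_div, mul_div_cancel₀ _ hA.ne'] at h1
  linarith [le_abs_self B]

/-- Raising the per-job cost by a factor `1 + ε` lowers the demand at least linearly in `ε`. -/
theorem exists_demand_scale (h : IsUser c α γ) : ∃ a, 0 < a ∧ ∀ ε, 0 ≤ ε → ε ≤ 1 →
    ∀ r, 0 < r → (1 + a * ε) * demand c α γ ((1 + ε) * r) ≤ demand c α γ r := by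
  obtain ⟨A, s, W, V, κ, hA, hs, -, -, -, -, hd, -⟩ := h.exists_powers one_pos 0
  -- For `0 ≤ ε ≤ 1`, `(1+ε)^s ≥ 1 + s log(1+ε) ≥ 1 + s ε/(1+ε) ≥ 1 + (s/2) ε`.
  refine ⟨s / 2, by positivity, fun ε hε hε1 r hr => ?_⟩
  have h1 : 0 < 1 + ε := by linarith
  have h2 : 1 + s / 2 * ε ≤ (1 + ε) ^ s := by
    rw [Real.rpow_def_of_pos h1]
    have h3 := Real.add_one_le_exp (Real.log (1 + ε) * s)
    have h4 := Real.one_sub_inv_le_log_of_pos h1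
    have h5 : ε / 2 ≤ 1 - (1 + ε)⁻¹ := by
      rw [show 1 - (1 + ε)⁻¹ = ε / (1 + ε) by field_simp; ring]
      exact div_le_div_of_nonneg_left hε h1 (by linarith)
    nlinarith
  rw [hd _ (by positivity), hd r hr, Real.mul_rpow h1.le hr.le, Real.rpow_neg h1.le]
  have h6 : 0 < (1 + ε) ^ s := by positivity
  have h7 : (1 + s / 2 * ε) * ((1 + ε) ^ s)⁻¹ ≤ 1 := by
    rw [← div_eq_mul_inv, div_le_one h6]; exact h2
  have h8 : 0 ≤ A * r ^ (-s) := by positivity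
  nlinarith

section Value

variable {ν β : ℝ}

/-- In the fairness term, the coefficient `V/(1-β)` and the exponent change sign together at `β =
1`, so the term decreases on both sides. -/
theorem userValue_antitone (h : IsUser c α γ) (hν : 0 < ν) (hβ1 : β ≠ 1) {r r' : ℝ}
    (hr : 0 < r) (hrr : r ≤ r') : userValue c α γ ν β r' ≤ userValue c α γ ν β r := by
  obtain ⟨A, s, W, V, κ, -, -, hW, hV, hκ, -, -, hv⟩ := h.exists_powers hν β
  have hr' := hr.trans_le hrr
  rw [hv r hr, hv r' hr']
  refine add_le_add (mul_le_mul_of_nonneg_left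
    (Real.rpow_le_rpow_of_nonpos hr hrr (by linarith)) hW.le) ?_
  rcases lt_or_gt_of_ne hβ1 with hβ | hβ
  · have h1 : 0 < 1 - β := by linarith
    exact mul_le_mul_of_nonneg_left (Real.rpow_le_rpow_of_nonpos hr hrr
      (by have := mul_pos hκ h1; linarith)) (by positivity)
  · have h1 : 1 - β < 0 := by linarith
    exact mul_le_mul_of_nonpos_left (Real.rpow_le_rpow hr.le hrr
      (by have := mul_neg_of_pos_of_neg hκ h1; linarith)) (div_nonpos_of_nonneg_of_nonpos hV.le h1.le)

theorem differentiableAt_userValue (h : IsUser c α γ) (hν : 0 < ν) {r : ℝ} (hr : 0 < r) :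
    DifferentiableAt ℝ (userValue c α γ ν β) r := by
  obtain ⟨A, s, W, V, κ, -, -, hW, hV, hκ, -, -, hv⟩ := h.exists_powers hν β
  have : DifferentiableAt ℝ
      (fun r : ℝ => W * r ^ (-κ) + V / (1 - β) * r ^ (-(κ * (1 - β)))) r :=
    ((Real.differentiableAt_rpow_const_of_ne _ hr.ne').const_mul _).add
      ((Real.differentiableAt_rpow_const_of_ne _ hr.ne').const_mul _)
  refine this.congr_of_eventuallyEq ?_
  filter_upwards [lt_mem_nhds hr] with y hy using hv y hy

theorem tendsto_userValue_atBot (h : IsUser c α γ) (hν : 0 < ν) (hβ : 1 < β) :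
    Tendsto (userValue c α γ ν β) atTop atBot := by
  obtain ⟨A, s, W, V, κ, -, -, hW, hV, hκ, -, -, hv⟩ := h.exists_powers hν β
  have h1 : 0 < -(κ * (1 - β)) := by nlinarith
  have h2 : V / (1 - β) < 0 := div_neg_of_pos_of_neg hV (by linarith)
  have : Tendsto (fun r : ℝ => W * r ^ (-κ) + V / (1 - β) * r ^ (-(κ * (1 - β)))) atTop atBot :=
    ((tendsto_rpow_neg_atTop hκ).const_mul W).add_atBot
      ((tendsto_rpow_atTop h1).const_mul_atTop_of_neg h2)
  refine this.congr' ?_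
  filter_upwards [eventually_gt_atTop 0] with y hy using (hv y hy).symm

theorem tendsto_userValue_zero (h : IsUser c α γ) (hν : 0 < ν) (hβ : β < 1) :
    Tendsto (userValue c α γ ν β) atTop (𝓝 0) := by
  obtain ⟨A, s, W, V, κ, -, -, hW, hV, hκ, -, -, hv⟩ := h.exists_powers hν β
  have h1 : 0 < κ * (1 - β) := mul_pos hκ (by linarith)
  have : Tendsto (fun r : ℝ => W * r ^ (-κ) + V / (1 - β) * r ^ (-(κ * (1 - β)))) atTop
      (𝓝 (W * 0 + V / (1 - β) * 0)) :=
    ((tendsto_rpow_neg_atTop hκ).const_mul W).add ((tendsto_rpow_neg_atTop h1).const_mul _)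
  simp only [mul_zero, add_zero] at this
  refine this.congr' ?_
  filter_upwards [eventually_gt_atTop 0] with y hy using (hv y hy).symm

/-- At high cost, the value of a user is large compared with her demand. -/
theorem eventually_demand_lt (h : IsUser c α γ) (hν : 0 < ν) (hβ : β < 1) (K : ℝ) :
    ∀ᶠ r in atTop, K * demand c α γ r < userValue c α γ ν β (2 * r) := by
  obtain ⟨A, s, W, V, κ, hA, hs, hW, hV, hκ, hκs, hd, hv⟩ := h.exists_powers hν β
  -- The ratio of demand to `r^(-κ)` vanishes since `κ < s`, while the revenue part alone is a fixed
  -- multiple of `r^(-κ)`. The factor `2` leaves room for a later scaling of prices by `1 + ε ≤ 2`.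
  have h1 : Tendsto (fun r : ℝ => K * A * r ^ (-(s - κ))) atTop (𝓝 (K * A * 0)) :=
    (tendsto_rpow_neg_atTop (by linarith)).const_mul _
  rw [mul_zero] at h1
  have h2 : 0 < W * 2 ^ (-κ) := by positivity
  filter_upwards [h1.eventually (gt_mem_nhds h2), eventually_gt_atTop 0] with r hr hr0
  have hβ' : 0 < 1 - β := by linarith
  rw [hd r hr0, hv _ (by positivity)]
  have h3 : 0 < V / (1 - β) * (2 * r) ^ (-(κ * (1 - β))) := by positivity
  have h4 : r ^ (-s) = r ^ (-(s - κ)) * r ^ (-κ) := by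
    rw [← Real.rpow_add hr0]; congr 1; ring
  have h5 : (2 * r) ^ (-κ) = 2 ^ (-κ) * r ^ (-κ) := Real.mul_rpow (by norm_num) hr0.le
  have h6 : 0 < r ^ (-κ) := by positivity
  have h7 := mul_lt_mul_of_pos_right hr h6
  rw [h4, h5]
  linarith

/-- Raising the per-job cost by a factor `1 + ε` lowers the value at most linearly in `ε`. -/
theorem exists_userValue_scale (h : IsUser c α γ) (hν : 0 < ν) (hβ0 : 0 < β) (hβ : β < 1)
    {r : ℝ} (hr : 0 < r) : ∃ B, 0 ≤ B ∧ ∀ ε, 0 ≤ ε →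
      userValue c α γ ν β r - B * ε ≤ userValue c α γ ν β ((1 + ε) * r) := by
  obtain ⟨A, s, W, V, κ, -, -, hW, hV, hκ, -, -, hv⟩ := h.exists_powers hν β
  have hβ' : 0 < 1 - β := by linarith
  -- This is `(1+ε)^(-e) ≥ 1 - e log(1+ε) ≥ 1 - e ε`, multiplied by `r^(-e)`.
  have key : ∀ e ε : ℝ, 0 ≤ e → 0 ≤ ε →
      r ^ (-e) - r ^ (-e) * e * ε ≤ ((1 + ε) * r) ^ (-e) := by
    intro e ε he hε
    have h1 : 0 < 1 + ε := by linarith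
    rw [Real.mul_rpow h1.le hr.le, Real.rpow_def_of_pos h1]
    have h3 := Real.add_one_le_exp (Real.log (1 + ε) * -e)
    have h4 := Real.log_le_sub_one_of_pos h1
    have h5 : 0 ≤ r ^ (-e) := by positivity
    have h6 : 1 - e * ε ≤ Real.exp (Real.log (1 + ε) * -e) := by nlinarith
    nlinarith
  refine ⟨W * (r ^ (-κ) * κ) +
    V / (1 - β) * (r ^ (-(κ * (1 - β))) * (κ * (1 - β))), by positivity, fun ε hε => ?_⟩
  rw [hv r hr, hv _ (by positivity)]
  have k1 := mul_le_mul_of_nonneg_left (key κ ε hκ.le hε) hW.le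
  have k2 := mul_le_mul_of_nonneg_left (key (κ * (1 - β)) ε (by positivity) hε)
    (show 0 ≤ V / (1 - β) by positivity)
  linarith

end Value

end IsUser

/-! ### Limits of prices along ultrafilters -/

/-- A linear map between finite-dimensional spaces has a continuous linear generalized inverse. -/
theorem LinearMap.exists_generalized_inverse {E F : Type*} [NormedAddCommGroup E]
    [NormedSpace ℝ E] [NormedAddCommGroup F] [NormedSpace ℝ F] [FiniteDimensional ℝ F]
    (A : E →ₗ[ℝ] F) : ∃ G : F →L[ℝ] E, ∀ p, A (G (A p)) = A p := by
  -- A linear section of `A` over its range, extended to all of `F`.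
  obtain ⟨g, hg⟩ := A.rangeRestrict.exists_rightInverse_of_surjective A.range_rangeRestrict
  obtain ⟨G, hG⟩ := g.exists_extend
  refine ⟨LinearMap.toContinuousLinearMap G, fun p => ?_⟩
  have h1 : G (A p) = g (A.rangeRestrict p) := LinearMap.congr_fun hG (A.rangeRestrict p)
  have h2 := LinearMap.congr_fun hg (A.rangeRestrict p)
  have h3 := congrArg Subtype.val h2
  simpa [h1] using h3

/-- An ultrafilter of reals that are bounded below tends to `+∞` or to a real limit. -/
theorem Ultrafilter.tendsto_atTop_or_nhds {X : Type*} (U : Ultrafilter X) (f : X → ℝ) (a : ℝ)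
    (hf : ∀ᶠ x in U, a ≤ f x) :
    Tendsto f U atTop ∨ ∃ r, a ≤ r ∧ Tendsto f U (𝓝 r) := by
  by_cases h : ∃ b, ∀ᶠ x in U, f x ≤ b
  · obtain ⟨b, hb⟩ := h
    right
    have hI : Set.Icc a b ∈ U.map f := by
      rw [Ultrafilter.mem_map]
      change ∀ᶠ x in U, f x ∈ Set.Icc a b
      filter_upwards [hf, hb] with x h1 h2 using ⟨h1, h2⟩
    obtain ⟨r, hr, hle⟩ := isCompact_Icc.ultrafilter_le_nhds' (U.map f) hI
    exact ⟨r, hr.1, hle⟩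
  · left
    push Not at h
    rw [tendsto_atTop]
    intro b
    filter_upwards [h b] with x hx using hx.le

/-! ### Admissible pricing problems and limits of their costs, loads and objective -/

namespace PricingProblem

variable {d k n : ℕ}

/-- The conditions on a pricing problem under which the interior-point algorithm converges. -/
structure Admissible (P : PricingProblem d k n) : Prop where
  k_pos : 0 < k
  isUser : ∀ j, IsUser (P.c j) (P.α j) P.γ
  exists_jobCost_pos : ∃ p, ∀ j, 0 < P.jobCost p j
  usage_nonneg : ∀ i j, 0 ≤ P.usage i j
  exists_usage_pos : ∀ j, ∃ i, 0 < P.usage i j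
  cap_pos : ∀ i, 0 < P.cap i

variable (P : PricingProblem d k n)

theorem objective_eq_sum (ν β : ℝ) (p : Fin d → ℝ) :
    P.objective ν β p = ∑ j, userValue (P.c j) (P.α j) P.γ ν β (P.jobCost p j) := by
  simp only [objective, revenue, fairness, userValue, received, jobs, Finset.mul_sum,
    Finset.sum_add_distrib]

theorem barrier_eq (ν β t : ℝ) (p : Fin d → ℝ) : P.barrier ν β t p =
    -t * P.objective ν β p - ∑ i, Real.log (P.cap i - P.load p i) := by
  simp only [barrier, objective]; ring

theorem jobCost_add (p q : Fin d → ℝ) (j : Fin n) :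
    P.jobCost (p + q) j = P.jobCost p j + P.jobCost q j := by
  simp [jobCost, mul_add, Finset.sum_add_distrib]

theorem jobCost_smul (a : ℝ) (p : Fin d → ℝ) (j : Fin n) :
    P.jobCost (a • p) j = a * P.jobCost p j := by
  simp only [jobCost, Pi.smul_apply, smul_eq_mul, Finset.mul_sum]
  exact Finset.sum_congr rfl fun _ _ => by ring

theorem differentiable_jobCost (j : Fin n) : Differentiable ℝ fun p => P.jobCost p j := by
  unfold jobCost; fun_prop

theorem continuous_jobCost (j : Fin n) : Continuous fun p => P.jobCost p j :=
  (P.differentiable_jobCost j).continuous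

theorem strictlyFeasible_subset : P.strictlyFeasible ⊆ P.feasible :=
  fun _ hp => ⟨hp.1, fun i => (hp.2 i).le⟩

/-- Prices can be moved so that the converging per-job costs take their limits and the diverging
ones still diverge. -/
theorem exists_lift (U : Filter (Fin d → ℝ)) (J : Set (Fin n)) (r : Fin n → ℝ)
    (hJ : ∀ j ∈ J, Tendsto (fun p => P.jobCost p j) U atTop)
    (hr : ∀ j ∉ J, Tendsto (fun p => P.jobCost p j) U (𝓝 (r j))) [U.NeBot] :
    ∃ Q : (Fin d → ℝ) → Fin d → ℝ, (∀ p, ∀ j ∉ J, P.jobCost (Q p) j = r j) ∧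
      (∀ j ∈ J, Tendsto (fun p => P.jobCost (Q p) j) U atTop) ∧
      Tendsto (fun p => dist p (Q p)) U (𝓝 0) := by
  classical
  -- `A` records only the converging costs.
  let A : (Fin d → ℝ) →ₗ[ℝ] (Fin n → ℝ) :=
    { toFun := fun p j => if j ∈ J then 0 else P.jobCost p j
      map_add' := fun p q => by ext j; by_cases h : j ∈ J <;> simp [h, jobCost_add]
      map_smul' := fun a p => by ext j; by_cases h : j ∈ J <;> simp [h, jobCost_smul] }
  obtain ⟨G, hG⟩ := A.exists_generalized_inverse
  let s : Fin n → ℝ := fun j => if j ∈ J then 0 else r j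
  have hA : Tendsto A U (𝓝 s) := by
    rw [tendsto_pi_nhds]
    intro j
    by_cases h : j ∈ J
    · simp [A, s, h]
    · simpa [A, s, h] using hr j h
  have hGA : Tendsto (fun p => G (A p)) U (𝓝 (G s)) := (G.continuous.tendsto s).comp hA
  -- The limit `s` of points of the range of `A` is again in the range, so the converging costs can
  -- be corrected exactly by `G s - G (A p)`, which tends to `0`.
  have hAs : A (G s) = s := by
    have h1 : Tendsto (fun p => A (G (A p))) U (𝓝 (A (G s))) :=
      (A.continuous_of_finiteDimensional.tendsto _).comp hGA
    simp only [hG] at h1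
    exact tendsto_nhds_unique h1 hA
  have hdiff : Tendsto (fun p => G s - G (A p)) U (𝓝 0) := by
    simpa using hGA.const_sub (G s)
  refine ⟨fun p => p + (G s - G (A p)), fun p j hj => ?_, fun j hj => ?_, ?_⟩
  · have h1 : A (p + (G s - G (A p))) = s := by
      rw [map_add, map_sub, hG, hAs]; abel
    have h2 := congrFun h1 j
    simpa [A, s, hj] using h2
  · simp only [jobCost_add]
    exact (hJ j hj).atTop_add (((P.continuous_jobCost j).tendsto 0).comp hdiff)
  · simpa [dist_eq_norm, norm_sub_rev] using hdiff.norm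

namespace Admissible

variable {P} {ν β : ℝ}

theorem jobs_pos (h : P.Admissible) {p : Fin d → ℝ} {j : Fin n} (hp : 0 < P.jobCost p j) :
    0 < P.jobs p j :=
  (h.isUser j).demand_pos hp

/-- The demand of a single user must fit into the capacity of one resource that she uses, and a
bounded demand forces a cost bounded away from `0`. -/
theorem exists_jobCost_lower_bound (h : P.Admissible) :
    ∃ r : Fin n → ℝ, (∀ j, 0 < r j) ∧ ∀ p ∈ P.feasible, ∀ j, r j ≤ P.jobCost p j := by
  have key : ∀ j, ∃ r, 0 < r ∧ ∀ p ∈ P.feasible, r ≤ P.jobCost p j := by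
    intro j
    obtain ⟨i, hi⟩ := h.exists_usage_pos j
    obtain ⟨r, hr, hle⟩ := (h.isUser j).exists_cost_lower_bound (P.cap i / P.usage i j)
    refine ⟨r, hr, fun p hp => hle _ (hp.1 j) ?_⟩
    rw [le_div_iff₀ hi, mul_comm]
    refine le_trans ?_ (hp.2 i)
    exact Finset.single_le_sum (f := fun j => P.usage i j * P.jobs p j)
      (fun j _ => mul_nonneg (h.usage_nonneg i j) (h.jobs_pos (hp.1 j)).le) (Finset.mem_univ j)
  choose r hr hle using key
  exact ⟨r, hr, fun p hp j => hle j p hp⟩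

theorem load_nonneg (h : P.Admissible) {p : Fin d → ℝ} (hp : ∀ j, 0 < P.jobCost p j)
    (i : Fin k) : 0 ≤ P.load p i :=
  Finset.sum_nonneg fun j _ => mul_nonneg (h.usage_nonneg i j) (h.jobs_pos (hp j)).le

theorem differentiableAt_load (h : P.Admissible) {p : Fin d → ℝ} (hp : ∀ j, 0 < P.jobCost p j)
    (i : Fin k) : DifferentiableAt ℝ (fun p => P.load p i) p := by
  unfold load
  refine DifferentiableAt.fun_sum fun j _ => DifferentiableAt.const_mul ?_ _
  exact ((h.isUser j).differentiableAt_demand (hp j)).comp p (P.differentiable_jobCost j p)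

theorem differentiableAt_objective (h : P.Admissible) (hν : 0 < ν) {p : Fin d → ℝ}
    (hp : ∀ j, 0 < P.jobCost p j) : DifferentiableAt ℝ (P.objective ν β) p := by
  have : P.objective ν β = _ := funext (P.objective_eq_sum ν β)
  rw [this]
  refine DifferentiableAt.fun_sum fun j _ => ?_
  exact ((h.isUser j).differentiableAt_userValue hν (hp j)).comp p (P.differentiable_jobCost j p)

theorem bddAbove_objective (h : P.Admissible) (hν : 0 < ν) (hβ1 : β ≠ 1) :
    ∃ V, ∀ p ∈ P.feasible, P.objective ν β p ≤ V := by
  obtain ⟨r, hr, hle⟩ := h.exists_jobCost_lower_bound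
  refine ⟨∑ j, userValue (P.c j) (P.α j) P.γ ν β (r j), fun p hp => ?_⟩
  rw [objective_eq_sum]
  exact Finset.sum_le_sum fun j _ => (h.isUser j).userValue_antitone hν hβ1 (hr j) (hle p hp j)

/-- Raising all prices by a factor `1 + ε` lowers the loads at least linearly in `ε`. -/
theorem exists_load_scale (h : P.Admissible) : ∃ a, 0 < a ∧ ∀ p, (∀ j, 0 < P.jobCost p j) →
    ∀ ε, 0 ≤ ε → ε ≤ 1 → ∀ i, (1 + a * ε) * P.load ((1 + ε) • p) i ≤ P.load p i := by
  choose a ha hs using fun j => (h.isUser j).exists_demand_scale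
  obtain ⟨a₀, ha₀, hle⟩ : ∃ a₀, 0 < a₀ ∧ ∀ j, a₀ ≤ a j := by
    rcases isEmpty_or_nonempty (Fin n) with hn | hn
    · exact ⟨1, one_pos, fun j => hn.elim j⟩
    · obtain ⟨j₀, hj₀⟩ := Finite.exists_min a
      exact ⟨a j₀, ha j₀, hj₀⟩
  refine ⟨a₀, ha₀, fun p hp ε hε hε1 i => ?_⟩
  unfold load
  rw [Finset.mul_sum]
  refine Finset.sum_le_sum fun j _ => ?_
  rw [mul_left_comm]
  refine mul_le_mul_of_nonneg_left (le_trans ?_ (hs j ε hε hε1 _ (hp j))) (h.usage_nonneg i j)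
  unfold jobs
  rw [jobCost_smul]
  exact mul_le_mul_of_nonneg_right (by nlinarith [hle j]) (demand_nonneg _ _ _ _)

/-- Provides strictly feasible prices arbitrarily close to any feasible ones, in particular to a
maximizer. -/
theorem scale_mem_strictlyFeasible (h : P.Admissible) {p : Fin d → ℝ} (hp : p ∈ P.feasible)
    {ε : ℝ} (hε : 0 < ε) (hε1 : ε ≤ 1) : (1 + ε) • p ∈ P.strictlyFeasible := by
  obtain ⟨a, ha, hs⟩ := h.exists_load_scale
  refine ⟨fun j => by rw [jobCost_smul]; exact mul_pos (by linarith) (hp.1 j), fun i => ?_⟩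
  nlinarith [hs p hp.1 ε hε.le hε1 i, hp.2 i, h.cap_pos i, mul_pos ha hε]

theorem strictlyFeasible_nonempty (h : P.Admissible) : P.strictlyFeasible.Nonempty := by
  obtain ⟨e, he⟩ := h.exists_jobCost_pos
  have h1 : ∀ i, ∀ᶠ a : ℝ in atTop, P.load (a • e) i < P.cap i := by
    intro i
    have h2 : Tendsto (fun a : ℝ => P.load (a • e) i) atTop (𝓝 (∑ j, P.usage i j * 0)) := by
      unfold load
      refine tendsto_finsetSum _ fun j _ => Tendsto.const_mul _ ?_
      have : Tendsto (fun a : ℝ => a * P.jobCost e j) atTop atTop :=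
        tendsto_id.atTop_mul_const (he j)
      simpa [Function.comp_def, jobs, jobCost_smul] using (h.isUser j).tendsto_demand.comp this
    simp only [mul_zero, Finset.sum_const_zero] at h2
    exact h2.eventually (gt_mem_nhds (h.cap_pos i))
  obtain ⟨a, ha, ha0⟩ := ((eventually_all.2 h1).and (eventually_gt_atTop 0)).exists
  exact ⟨a • e, fun j => by rw [jobCost_smul]; exact mul_pos ha0 (he j), ha⟩

/-- Along an ultrafilter of feasible prices some per-job costs diverge to `+∞` and the others have
positive limits; the prices can be moved so that the latter take their limits. -/
theorem exists_limit (h : P.Admissible) (U : Ultrafilter (Fin d → ℝ)) (hU : P.feasible ∈ U) :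
    ∃ (J : Finset (Fin n)) (r : Fin n → ℝ) (Q : (Fin d → ℝ) → Fin d → ℝ), (∀ j, 0 < r j) ∧
      (∀ j ∈ J, Tendsto (fun p => P.jobCost p j) U atTop) ∧
      (∀ j ∉ J, Tendsto (fun p => P.jobCost p j) U (𝓝 (r j))) ∧
      (∀ p, ∀ j ∉ J, P.jobCost (Q p) j = r j) ∧
      (∀ j ∈ J, Tendsto (fun p => P.jobCost (Q p) j) U atTop) ∧
      Tendsto (fun p => dist p (Q p)) U (𝓝 0) := by
  classical
  obtain ⟨r₀, hr₀, hle⟩ := h.exists_jobCost_lower_bound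
  let J : Finset (Fin n) := {j | Tendsto (fun p => P.jobCost p j) U atTop}
  have hlim : ∀ j, ∃ r, 0 < r ∧ (j ∉ J → Tendsto (fun p => P.jobCost p j) U (𝓝 r)) := by
    intro j
    rcases U.tendsto_atTop_or_nhds (fun p => P.jobCost p j) (r₀ j)
      (by filter_upwards [hU] with p hp using hle p hp j) with hj | ⟨r, hr, hj⟩
    · exact ⟨1, one_pos, fun hn => absurd (by simpa [J] using hj) hn⟩
    · exact ⟨r, (hr₀ j).trans_le hr, fun _ => hj⟩
  choose r hr hlim using hlim
  have hJ : ∀ j ∈ J, Tendsto (fun p => P.jobCost p j) U atTop := fun j hj => by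
    simpa [J] using hj
  obtain ⟨Q, h1, h2, h3⟩ := P.exists_lift (U : Filter (Fin d → ℝ)) (J : Set (Fin n)) r
    (fun j hj => hJ j (by simpa using hj)) (fun j hj => hlim j (by simpa using hj))
  exact ⟨J, r, Q, hr, hJ, hlim, fun p j hj => h1 p j (by simpa using hj),
    fun j hj => h2 j (by simpa using hj), h3⟩

section Limit

variable {U : Filter (Fin d → ℝ)} {J : Finset (Fin n)} {r : Fin n → ℝ}

theorem tendsto_load (h : P.Admissible) (hr : ∀ j, 0 < r j)
    (hJ : ∀ j ∈ J, Tendsto (fun p => P.jobCost p j) U atTop)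
    (hJc : ∀ j ∉ J, Tendsto (fun p => P.jobCost p j) U (𝓝 (r j))) (i : Fin k) :
    Tendsto (fun p => P.load p i) U
      (𝓝 (∑ j ∈ Jᶜ, P.usage i j * demand (P.c j) (P.α j) P.γ (r j))) := by
  classical
  have h0 : ∀ j ∈ J, Tendsto (fun p => P.usage i j * P.jobs p j) U (𝓝 (P.usage i j * 0)) :=
    fun j hj => ((h.isUser j).tendsto_demand.comp (hJ j hj)).const_mul _
  have h1 : ∀ j ∈ Jᶜ, Tendsto (fun p => P.usage i j * P.jobs p j) U
      (𝓝 (P.usage i j * demand (P.c j) (P.α j) P.γ (r j))) := fun j hj =>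
    (((h.isUser j).differentiableAt_demand (hr j)).continuousAt.tendsto.comp
      (hJc j (Finset.mem_compl.1 hj))).const_mul _
  have := (tendsto_finsetSum _ h0).add (tendsto_finsetSum _ h1)
  simp only [mul_zero, Finset.sum_const_zero, zero_add, Finset.sum_add_sum_compl] at this
  exact this

/-- Users with diverging costs contribute nothing in the limit; `β < 1` is needed only if there are
such users. -/
theorem tendsto_objective (h : P.Admissible) (hν : 0 < ν) (hβ : J.Nonempty → β < 1)
    (hr : ∀ j, 0 < r j) (hJ : ∀ j ∈ J, Tendsto (fun p => P.jobCost p j) U atTop)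
    (hJc : ∀ j ∉ J, Tendsto (fun p => P.jobCost p j) U (𝓝 (r j))) :
    Tendsto (P.objective ν β) U
      (𝓝 (∑ j ∈ Jᶜ, userValue (P.c j) (P.α j) P.γ ν β (r j))) := by
  classical
  have h0 : ∀ j ∈ J, Tendsto
      (fun p => userValue (P.c j) (P.α j) P.γ ν β (P.jobCost p j)) U (𝓝 0) :=
    fun j hj => ((h.isUser j).tendsto_userValue_zero hν (hβ ⟨j, hj⟩)).comp (hJ j hj)
  have h1 : ∀ j ∈ Jᶜ, Tendsto (fun p => userValue (P.c j) (P.α j) P.γ ν β (P.jobCost p j)) U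
      (𝓝 (userValue (P.c j) (P.α j) P.γ ν β (r j))) := fun j hj =>
    ((h.isUser j).differentiableAt_userValue hν (hr j)).continuousAt.tendsto.comp
      (hJc j (Finset.mem_compl.1 hj))
  have := (tendsto_finsetSum _ h0).add (tendsto_finsetSum _ h1)
  simp only [Finset.sum_const_zero, zero_add, Finset.sum_add_sum_compl] at this
  exact this.congr fun p => (P.objective_eq_sum ν β p).symm

/-- If per-job costs diverge along feasible prices on which the objective stays bounded below,
then `β < 1`. -/
theorem lt_one_of_tendsto_atTop (h : P.Admissible) (hν : 0 < ν) (hβ1 : β ≠ 1) [U.NeBot]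
    (hU : P.feasible ∈ U) (hJ : ∀ j ∈ J, Tendsto (fun p => P.jobCost p j) U atTop)
    {V : ℝ} (hV : ∀ᶠ p in U, V ≤ P.objective ν β p) (hne : J.Nonempty) : β < 1 := by
  classical
  by_contra hβ
  have hβ' : 1 < β := lt_of_le_of_ne (not_lt.1 hβ) hβ1.symm
  obtain ⟨j, hj⟩ := hne
  obtain ⟨r, hr, hle⟩ := h.exists_jobCost_lower_bound
  have h1 := ((h.isUser j).tendsto_userValue_atBot hν hβ').comp (hJ j hj)
  have h2 := h1.eventually (eventually_lt_atBot
    (V - ∑ i ∈ Finset.univ.erase j, userValue (P.c i) (P.α i) P.γ ν β (r i)))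
  obtain ⟨p, hp1, hp2, hp3⟩ := (h2.and (hV.and hU)).exists
  rw [objective_eq_sum, ← Finset.add_sum_erase _ _ (Finset.mem_univ j)] at hp2
  have h3 : ∑ i ∈ Finset.univ.erase j, userValue (P.c i) (P.α i) P.γ ν β (P.jobCost p i) ≤
      ∑ i ∈ Finset.univ.erase j, userValue (P.c i) (P.α i) P.γ ν β (r i) :=
    Finset.sum_le_sum fun i _ => (h.isUser i).userValue_antitone hν hβ1 (hr i) (hle p hp3 i)
  simp only [Function.comp_apply] at hp1
  linarith

end Limit

end Admissible
end PricingProblem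

/-! ### Existence and stability of maximizers -/

namespace PricingProblem

variable {d k n : ℕ} {P : PricingProblem d k n} {ν β : ℝ}

namespace Admissible

/-- If some per-job costs diverge along feasible prices, there are feasible prices with a better
objective value than in the limit. -/
theorem exists_feasible_gt (h : P.Admissible) (hν : 0 < ν) (hβ0 : 0 < β) (hβ : β < 1)
    {U : Filter (Fin d → ℝ)} [U.NeBot] {J : Finset (Fin n)} (hne : J.Nonempty) {r : Fin n → ℝ}
    (hr : ∀ j, 0 < r j) {Q : (Fin d → ℝ) → Fin d → ℝ}
    (hcap : ∀ i, ∑ j ∈ Jᶜ, P.usage i j * demand (P.c j) (P.α j) P.γ (r j) ≤ P.cap i)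
    (hQc : ∀ p, ∀ j ∉ J, P.jobCost (Q p) j = r j)
    (hQ : ∀ j ∈ J, Tendsto (fun p => P.jobCost (Q p) j) U atTop) :
    ∃ q ∈ P.feasible,
      ∑ j ∈ Jᶜ, userValue (P.c j) (P.α j) P.γ ν β (r j) < P.objective ν β q := by
  classical
  obtain ⟨a, ha, hs⟩ := h.exists_load_scale
  choose B hB0 hB using fun j => (h.isUser j).exists_userValue_scale hν hβ0 hβ (hr j)
  -- Readmitting the users in `J` adds at most `a * ε * cap i` to each load, by summing the bounds
  -- over all resources. Raising all prices by `1 + ε` makes up for it, since it divides loads by at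
  -- least `1 + a * ε`.
  let K : Fin n → ℝ := fun j => ∑ i, P.usage i j / (a * P.cap i)
  let ε : (Fin d → ℝ) → ℝ := fun p => ∑ j ∈ J, K j * P.jobs (Q p) j
  have hε : Tendsto ε U (𝓝 (∑ j ∈ J, K j * 0)) :=
    tendsto_finsetSum _ fun j hj => ((h.isUser j).tendsto_demand.comp (hQ j hj)).const_mul _
  simp only [mul_zero, Finset.sum_const_zero] at hε
  -- The users outside `J` lose at most `(∑ B) * ε`; split according to the definition of `ε`, this
  -- loss is beaten term by term by the values of the users in `J`.
  have hbig : ∀ j ∈ J, ∀ᶠ p in U, (∑ j ∈ Jᶜ, B j) * K j * P.jobs (Q p) j <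
      userValue (P.c j) (P.α j) P.γ ν β (2 * P.jobCost (Q p) j) := fun j hj =>
    (hQ j hj).eventually ((h.isUser j).eventually_demand_lt hν hβ ((∑ j ∈ Jᶜ, B j) * K j))
  have hpos : ∀ j ∈ J, ∀ᶠ p in U, 0 < P.jobCost (Q p) j := fun j hj =>
    (hQ j hj).eventually (eventually_gt_atTop 0)
  obtain ⟨p, hp1, hp2, hp3⟩ := ((hε.eventually (gt_mem_nhds one_pos)).and
    (((J.eventually_all).2 hbig).and ((J.eventually_all).2 hpos))).exists
  have hc : ∀ j, 0 < P.jobCost (Q p) j := fun j => by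
    by_cases hj : j ∈ J
    · exact hp3 j hj
    · rw [hQc p j hj]; exact hr j
  have hjob : ∀ j, 0 ≤ P.jobs (Q p) j := fun j => (h.jobs_pos (hc j)).le
  have hKi : ∀ i j, 0 ≤ P.usage i j / (a * P.cap i) := fun i j =>
    div_nonneg (h.usage_nonneg i j) (mul_pos ha (h.cap_pos i)).le
  have hε0 : 0 ≤ ε p := Finset.sum_nonneg fun j _ =>
    mul_nonneg (Finset.sum_nonneg fun i _ => hKi i j) (hjob j)
  refine ⟨(1 + ε p) • Q p, ⟨fun j => ?_, fun i => ?_⟩, ?_⟩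
  · rw [jobCost_smul]; exact mul_pos (by linarith) (hc j)
  · have h1 := hs (Q p) hc (ε p) hε0 hp1.le i
    have h2 : P.load (Q p) i =
        ∑ j ∈ J, P.usage i j * P.jobs (Q p) j +
          ∑ j ∈ Jᶜ, P.usage i j * demand (P.c j) (P.α j) P.γ (r j) := by
      unfold load
      rw [← Finset.sum_add_sum_compl J]
      congr 1
      refine Finset.sum_congr rfl fun j hj => ?_
      rw [jobs, hQc p j (Finset.mem_compl.1 hj)]
    have h3 : ∑ j ∈ J, P.usage i j * P.jobs (Q p) j ≤ a * ε p * P.cap i := by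
      rw [mul_right_comm, Finset.mul_sum]
      refine Finset.sum_le_sum fun j _ => ?_
      rw [← mul_assoc]
      refine mul_le_mul_of_nonneg_right ?_ (hjob j)
      have h4 := Finset.single_le_sum (f := fun i => P.usage i j / (a * P.cap i))
        (fun i _ => hKi i j) (Finset.mem_univ i)
      rwa [div_le_iff₀' (mul_pos ha (h.cap_pos i))] at h4
    have h5 : (1 + a * ε p) * P.load ((1 + ε p) • Q p) i ≤ (1 + a * ε p) * P.cap i := by
      linarith [hcap i]
    exact le_of_mul_le_mul_left h5 (by positivity)
  · have h1 : ∑ j ∈ Jᶜ, (userValue (P.c j) (P.α j) P.γ ν β (r j) - B j * ε p) ≤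
        ∑ j ∈ Jᶜ, userValue (P.c j) (P.α j) P.γ ν β (P.jobCost ((1 + ε p) • Q p) j) := by
      refine Finset.sum_le_sum fun j hj => ?_
      rw [jobCost_smul, hQc p j (Finset.mem_compl.1 hj)]
      exact hB j (ε p) hε0
    have h2 : ∑ j ∈ J, (∑ j ∈ Jᶜ, B j) * K j * P.jobs (Q p) j <
        ∑ j ∈ J, userValue (P.c j) (P.α j) P.γ ν β (P.jobCost ((1 + ε p) • Q p) j) := by
      refine Finset.sum_lt_sum_of_nonempty hne fun j hj => (hp2 j hj).trans_le ?_
      rw [jobCost_smul]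
      exact (h.isUser j).userValue_antitone hν hβ.ne (mul_pos (by linarith) (hc j))
        (mul_le_mul_of_nonneg_right (by linarith) (hc j).le)
    have h3 : ∑ j ∈ J, (∑ j ∈ Jᶜ, B j) * K j * P.jobs (Q p) j = (∑ j ∈ Jᶜ, B j) * ε p := by
      simp only [ε, Finset.mul_sum, mul_assoc]
    rw [Finset.sum_sub_distrib, ← Finset.sum_mul] at h1
    rw [objective_eq_sum, ← Finset.sum_add_sum_compl J]
    linarith

/-- Feasible prices whose objective values tend to the supremum approach the maximizers. -/
theorem exists_near_maximizers (h : P.Admissible) (hν : 0 < ν) (hβ0 : 0 < β) (hβ1 : β ≠ 1)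
    (U : Ultrafilter (Fin d → ℝ)) (hU : P.feasible ∈ U) {V : ℝ}
    (hV : Tendsto (P.objective ν β) U (𝓝 V)) (hmax : ∀ q ∈ P.feasible, P.objective ν β q ≤ V) :
    ∃ Q : (Fin d → ℝ) → Fin d → ℝ, (∀ p, Q p ∈ P.maximizers ν β ∧ P.objective ν β (Q p) = V) ∧
      Tendsto (fun p => dist p (Q p)) U (𝓝 0) := by
  obtain ⟨J, r, Q, hr, hJ, hJc, hQc, hQ, hdist⟩ := h.exists_limit U hU
  have hβ : J.Nonempty → β < 1 := h.lt_one_of_tendsto_atTop (U := (U : Filter (Fin d → ℝ)))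
    hν hβ1 hU hJ (hV.eventually (lt_mem_nhds (sub_one_lt V)) |>.mono fun _ hp => hp.le)
  have hcap : ∀ i, ∑ j ∈ Jᶜ, P.usage i j * demand (P.c j) (P.α j) P.γ (r j) ≤ P.cap i := fun i =>
    le_of_tendsto (h.tendsto_load hr hJ hJc i) (by filter_upwards [hU] with p hp using hp.2 i)
  have hVeq := tendsto_nhds_unique hV (h.tendsto_objective hν hβ hr hJ hJc)
  -- Without diverging costs, the moved prices have exactly the limiting costs and hence the value
  -- `V`. Otherwise some feasible prices would exceed the supremum.
  rcases J.eq_empty_or_nonempty with rfl | hne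
  · have hc : ∀ p j, P.jobCost (Q p) j = r j := fun p j => hQc p j (by simp)
    have hobj : ∀ p, P.objective ν β (Q p) = V := fun p => by
      rw [objective_eq_sum, hVeq]; simp [hc]
    refine ⟨Q, fun p => ⟨⟨⟨fun j => by rw [hc]; exact hr j, fun i => ?_⟩, fun q hq => ?_⟩,
      hobj p⟩, hdist⟩
    · simpa [load, jobs, hc] using hcap i
    · rw [hobj]; exact hmax q hq
  · obtain ⟨q, hq, hlt⟩ := h.exists_feasible_gt hν hβ0 (hβ hne) hne hr hcap hQc hQ
    have := hmax q hq
    linarith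

theorem maximizers_nonempty (h : P.Admissible) (hν : 0 < ν) (hβ0 : 0 < β) (hβ1 : β ≠ 1) :
    (P.maximizers ν β).Nonempty := by
  obtain ⟨q₀, hq₀⟩ := h.strictlyFeasible_nonempty
  obtain ⟨B, hB⟩ := h.bddAbove_objective (β := β) hν hβ1
  have hlub := isLUB_csSup (s := P.objective ν β '' P.feasible)
    ⟨_, q₀, P.strictlyFeasible_subset hq₀, rfl⟩
    ⟨B, by rintro _ ⟨p, hp, rfl⟩; exact hB p hp⟩
  set V := sSup (P.objective ν β '' P.feasible)
  obtain ⟨u, -, hu, huS⟩ := hlub.exists_seq_monotone_tendsto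
    ⟨_, q₀, P.strictlyFeasible_subset hq₀, rfl⟩
  choose p hp hpu using huS.2
  let U : Ultrafilter (Fin d → ℝ) := (Ultrafilter.of (atTop : Filter ℕ)).map p
  have hUV : Tendsto (P.objective ν β) U (𝓝 V) := by
    have h1 : Tendsto (fun s => P.objective ν β (p s)) (Ultrafilter.of (atTop : Filter ℕ)) (𝓝 V) :=
      (huS.1.congr fun s => (hpu s).symm).mono_left (Ultrafilter.of_le _)
    exact tendsto_map'_iff.2 h1
  obtain ⟨Q, hQ, -⟩ := h.exists_near_maximizers hν hβ0 hβ1 U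
    (Filter.mem_map.2 (univ_mem' hp)) hUV fun q hq => hlub.1 ⟨q, hq, rfl⟩
  exact ⟨Q q₀, (hQ q₀).1⟩

/-- Prices with nearly maximal objective value are near the maximizers. -/
theorem tendsto_infDist (h : P.Admissible) (hν : 0 < ν) (hβ0 : 0 < β) (hβ1 : β ≠ 1)
    {q : Fin d → ℝ} (hq : q ∈ P.maximizers ν β) {X : Type*} {l : Filter X} {p : X → Fin d → ℝ}
    (hp : ∀ᶠ x in l, p x ∈ P.feasible)
    (hobj : Tendsto (fun x => P.objective ν β (p x)) l (𝓝 (P.objective ν β q))) :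
    Tendsto (fun x => Metric.infDist (p x) (P.maximizers ν β)) l (𝓝 0) := by
  rw [tendsto_iff_ultrafilter]
  intro U hU
  obtain ⟨Q, hQ, hdist⟩ := h.exists_near_maximizers hν hβ0 hβ1 (U.map p)
    (hU hp) (tendsto_map'_iff.2 (hobj.mono_left hU)) hq.2
  exact squeeze_zero (fun _ => Metric.infDist_nonneg)
    (fun x => Metric.infDist_le_dist_of_mem (hQ (p x)).1) (tendsto_map'_iff.1 hdist)

/-- The uniform lower bound on costs keeps them positive in the limit, where loads and objective are
continuous. -/
theorem isClosed_maximizers (h : P.Admissible) (hν : 0 < ν) :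
    IsClosed (P.maximizers ν β) := by
  rw [isClosed_iff_ultrafilter]
  intro q U hUq hU
  obtain ⟨r, hr, hle⟩ := h.exists_jobCost_lower_bound
  have hpos : ∀ j, 0 < P.jobCost q j := fun j => (hr j).trans_le <|
    ge_of_tendsto (((P.continuous_jobCost j).tendsto q).mono_left hUq)
      (by filter_upwards [hU] with p hp using hle p hp.1 j)
  refine ⟨⟨hpos, fun i => ?_⟩, fun p hp => ?_⟩
  · exact le_of_tendsto ((h.differentiableAt_load hpos i).continuousAt.tendsto.mono_left hUq)
      (by filter_upwards [hU] with p hp using hp.1.2 i)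
  · exact ge_of_tendsto
      ((h.differentiableAt_objective hν hpos).continuousAt.tendsto.mono_left hUq)
      (by filter_upwards [hU] with p' hp' using hp'.2 p hp)

end Admissible
end PricingProblem

/-! ### Minimizers of the barrier function -/

/-- A linear lower bound for the logarithm near a positive number. -/
theorem Real.log_sub_two_mul_div_le_log_sub {D y : ℝ} (hD : 0 < D) (hy : 0 ≤ y)
    (hyD : y ≤ D / 2) : Real.log D - 2 * y / D ≤ Real.log (D - y) := by
  have h1 : 0 < D - y := by linarith
  have h2 := Real.one_sub_inv_le_log_of_pos (div_pos h1 hD)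
  rw [Real.log_div h1.ne' hD.ne', inv_div] at h2
  have h3 : D / (D - y) ≤ 1 + 2 * y / D := by
    rw [div_le_iff₀ h1]
    field_simp
    nlinarith
  linarith

namespace PricingProblem

variable {d k n : ℕ} {P : PricingProblem d k n} {ν β : ℝ}

namespace Admissible

theorem log_slack_le (h : P.Admissible) {p : Fin d → ℝ} (hp : p ∈ P.strictlyFeasible)
    (i : Fin k) : Real.log (P.cap i - P.load p i) ≤ Real.log (P.cap i) :=
  Real.log_le_log (sub_pos.2 (hp.2 i)) (by linarith [h.load_nonneg hp.1 i])

/-- If some per-job costs diverge along strictly feasible prices, there are strictly feasible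
prices with a smaller barrier function than in the limit. -/
theorem exists_strictlyFeasible_lt (h : P.Admissible) (hν : 0 < ν) (hβ : β < 1)
    {t : ℝ} (ht : 0 < t) {U : Filter (Fin d → ℝ)} [U.NeBot] {J : Finset (Fin n)}
    (hne : J.Nonempty) {r : Fin n → ℝ} (hr : ∀ j, 0 < r j) {Q : (Fin d → ℝ) → Fin d → ℝ}
    {S : Fin k → ℝ}
    (hS : ∀ i, S i = P.cap i - ∑ j ∈ Jᶜ, P.usage i j * demand (P.c j) (P.α j) P.γ (r j))
    (hS0 : ∀ i, 0 < S i) (hQc : ∀ p, ∀ j ∉ J, P.jobCost (Q p) j = r j)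
    (hQ : ∀ j ∈ J, Tendsto (fun p => P.jobCost (Q p) j) U atTop) :
    ∃ q ∈ P.strictlyFeasible, P.barrier ν β t q <
      -t * ∑ j ∈ Jᶜ, userValue (P.c j) (P.α j) P.γ ν β (r j) - ∑ i, Real.log (S i) := by
  classical
  -- Since the limiting slacks are positive, readmitting the users in `J` costs at most `∑ 2 y i / S
  -- i` in logarithms, which is linear in their demands with coefficients `K j`. Their values,
  -- weighted by `t`, exceed this.
  let K : Fin n → ℝ := fun j => ∑ i, 2 * P.usage i j / S i
  let y : Fin k → (Fin d → ℝ) → ℝ := fun i p => ∑ j ∈ J, P.usage i j * P.jobs (Q p) j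
  have hy : ∀ i, Tendsto (y i) U (𝓝 (∑ j ∈ J, P.usage i j * 0)) := fun i =>
    tendsto_finsetSum _ fun j hj => ((h.isUser j).tendsto_demand.comp (hQ j hj)).const_mul _
  simp only [mul_zero, Finset.sum_const_zero] at hy
  have hbig : ∀ j ∈ J, ∀ᶠ p in U, K j / t * P.jobs (Q p) j <
      userValue (P.c j) (P.α j) P.γ ν β (2 * P.jobCost (Q p) j) := fun j hj =>
    (hQ j hj).eventually ((h.isUser j).eventually_demand_lt hν hβ (K j / t))
  have hpos : ∀ j ∈ J, ∀ᶠ p in U, 0 < P.jobCost (Q p) j := fun j hj =>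
    (hQ j hj).eventually (eventually_gt_atTop 0)
  have hysmall : ∀ i, ∀ᶠ p in U, y i p < S i / 2 := fun i =>
    (hy i).eventually (gt_mem_nhds (half_pos (hS0 i)))
  obtain ⟨p, hp1, hp2, hp3⟩ := ((eventually_all.2 hysmall).and
    (((J.eventually_all).2 hbig).and ((J.eventually_all).2 hpos))).exists
  have hc : ∀ j, 0 < P.jobCost (Q p) j := fun j => by
    by_cases hj : j ∈ J
    · exact hp3 j hj
    · rw [hQc p j hj]; exact hr j
  have hload : ∀ i, P.cap i - P.load (Q p) i = S i - y i p := fun i => by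
    have : P.load (Q p) i = y i p +
        ∑ j ∈ Jᶜ, P.usage i j * demand (P.c j) (P.α j) P.γ (r j) := by
      unfold load
      rw [← Finset.sum_add_sum_compl J]
      congr 1
      refine Finset.sum_congr rfl fun j hj => ?_
      rw [jobs, hQc p j (Finset.mem_compl.1 hj)]
    rw [this, hS]; ring
  have hy0 : ∀ i, 0 ≤ y i p := fun i => Finset.sum_nonneg fun j _ =>
    mul_nonneg (h.usage_nonneg i j) (h.jobs_pos (hc j)).le
  refine ⟨Q p, ⟨hc, fun i => ?_⟩, ?_⟩
  · rw [← sub_pos, hload]; linarith [hp1 i, hS0 i]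
  · have h1 : ∑ i, (Real.log (S i) - 2 * y i p / S i) ≤
        ∑ i, Real.log (P.cap i - P.load (Q p) i) := by
      refine Finset.sum_le_sum fun i _ => ?_
      rw [hload]
      exact Real.log_sub_two_mul_div_le_log_sub (hS0 i) (hy0 i) (hp1 i).le
    have h2 : ∑ i, 2 * y i p / S i = t * ∑ j ∈ J, K j / t * P.jobs (Q p) j := by
      simp only [y, K, Finset.mul_sum, Finset.sum_div, Finset.sum_mul]
      rw [Finset.sum_comm]
      refine Finset.sum_congr rfl fun j _ => Finset.sum_congr rfl fun i _ => ?_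
      field_simp
    have h3 : ∑ j ∈ J, K j / t * P.jobs (Q p) j <
        ∑ j ∈ J, userValue (P.c j) (P.α j) P.γ ν β (P.jobCost (Q p) j) := by
      refine Finset.sum_lt_sum_of_nonempty hne fun j hj => (hp2 j hj).trans_le ?_
      exact (h.isUser j).userValue_antitone hν hβ.ne (hc j) (by linarith [hc j])
    have h4 : P.objective ν β (Q p) =
        ∑ j ∈ J, userValue (P.c j) (P.α j) P.γ ν β (P.jobCost (Q p) j) +
          ∑ j ∈ Jᶜ, userValue (P.c j) (P.α j) P.γ ν β (r j) := by
      rw [objective_eq_sum, ← Finset.sum_add_sum_compl J]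
      congr 1
      refine Finset.sum_congr rfl fun j hj => ?_
      rw [hQc p j (Finset.mem_compl.1 hj)]
    rw [Finset.sum_sub_distrib, h2] at h1
    rw [barrier_eq, h4]
    nlinarith [mul_lt_mul_of_pos_left h3 ht]

/-- The slacks stay positive in the limit when the barrier function stays bounded above. -/
theorem limit_slack_pos (h : P.Admissible) (hν : 0 < ν) (hβ1 : β ≠ 1) {t : ℝ} (ht : 0 < t)
    {U : Filter (Fin d → ℝ)} [U.NeBot] (hU : P.strictlyFeasible ∈ U) {b : ℝ}
    (hb : ∀ᶠ p in U, P.barrier ν β t p ≤ b) {i : Fin k} {s : ℝ}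
    (hs : Tendsto (fun p => P.cap i - P.load p i) U (𝓝 s)) : 0 < s := by
  classical
  have hs0 : 0 ≤ s := ge_of_tendsto hs (by filter_upwards [hU] with p hp using
    (sub_pos.2 (hp.2 i)).le)
  refine hs0.lt_of_ne fun h0 => ?_
  subst h0
  obtain ⟨B, hB⟩ := h.bddAbove_objective (β := β) hν hβ1
  have h1 : Tendsto (fun p => P.cap i - P.load p i) U (𝓝[>] 0) :=
    tendsto_nhdsWithin_iff.2 ⟨hs, by filter_upwards [hU] with p hp using sub_pos.2 (hp.2 i)⟩
  -- Below this threshold the `i`-th logarithm alone pushes the barrier function above `b`, since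
  -- the objective is at most `B` and the other logarithms are at most `log (cap l)`.
  have h2 := (Real.tendsto_log_nhdsGT_zero.comp h1).eventually (eventually_lt_atBot
    (-t * B - b - ∑ l ∈ Finset.univ.erase i, Real.log (P.cap l)))
  obtain ⟨p, hp1, hp2, hp3⟩ := (h2.and (hb.and hU)).exists
  rw [barrier_eq, ← Finset.add_sum_erase _ _ (Finset.mem_univ i)] at hp2
  have h3 : ∑ l ∈ Finset.univ.erase i, Real.log (P.cap l - P.load p l) ≤
      ∑ l ∈ Finset.univ.erase i, Real.log (P.cap l) :=
    Finset.sum_le_sum fun l _ => h.log_slack_le hp3 l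
  have h4 := mul_le_mul_of_nonneg_left (hB p (P.strictlyFeasible_subset hp3)) ht.le
  simp only [Function.comp_apply] at hp1
  linarith

/-- The barrier function attains its minimum over the strictly feasible prices. -/
theorem exists_barrier_minimizer (h : P.Admissible) (hν : 0 < ν) (hβ1 : β ≠ 1)
    {t : ℝ} (ht : 0 < t) : ∃ p ∈ P.strictlyFeasible, ∀ q ∈ P.strictlyFeasible,
      P.barrier ν β t p ≤ P.barrier ν β t q := by
  classical
  obtain ⟨q₀, hq₀⟩ := h.strictlyFeasible_nonempty
  obtain ⟨B, hB⟩ := h.bddAbove_objective (β := β) hν hβ1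
  have hbelow : ∀ p ∈ P.strictlyFeasible,
      -t * B - ∑ i, Real.log (P.cap i) ≤ P.barrier ν β t p := by
    intro p hp
    have h1 : ∑ i, Real.log (P.cap i - P.load p i) ≤ ∑ i, Real.log (P.cap i) :=
      Finset.sum_le_sum fun i _ => h.log_slack_le hp i
    have h2 := mul_le_mul_of_nonneg_left (hB p (P.strictlyFeasible_subset hp)) ht.le
    rw [barrier_eq]
    linarith
  have hglb := isGLB_csInf (s := P.barrier ν β t '' P.strictlyFeasible) ⟨_, q₀, hq₀, rfl⟩
    ⟨_, by rintro _ ⟨p, hp, rfl⟩; exact hbelow p hp⟩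
  set I := sInf (P.barrier ν β t '' P.strictlyFeasible)
  have hI : ∀ q ∈ P.strictlyFeasible, I ≤ P.barrier ν β t q := fun q hq => hglb.1 ⟨q, hq, rfl⟩
  obtain ⟨u, -, hu, huS⟩ := hglb.exists_seq_antitone_tendsto ⟨_, q₀, hq₀, rfl⟩
  choose p hp hpu using huS.2
  let U : Ultrafilter (Fin d → ℝ) := (Ultrafilter.of (atTop : Filter ℕ)).map p
  have hUI : Tendsto (P.barrier ν β t) U (𝓝 I) := by
    have h1 : Tendsto (fun s => P.barrier ν β t (p s)) (Ultrafilter.of (atTop : Filter ℕ)) (𝓝 I) :=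
      (huS.1.congr fun s => (hpu s).symm).mono_left (Ultrafilter.of_le _)
    exact tendsto_map'_iff.2 h1
  have hU : P.strictlyFeasible ∈ U := Filter.mem_map.2 (univ_mem' hp)
  have hUf : P.feasible ∈ U := mem_of_superset hU P.strictlyFeasible_subset
  have hb : ∀ᶠ p in U, P.barrier ν β t p ≤ I + 1 :=
    (hUI.eventually (gt_mem_nhds (lt_add_one I))).mono fun _ hp => hp.le
  obtain ⟨J, r, Q, hr, hJ, hJc, hQc, hQ, -⟩ := h.exists_limit U hUf
  -- The logarithms are bounded above, so a bounded barrier function bounds the objective from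
  -- below; this excludes diverging costs when `β > 1`.
  have hobj : ∀ᶠ p in U, (-(I + 1) - ∑ i, Real.log (P.cap i)) / t ≤ P.objective ν β p := by
    filter_upwards [hb, hU] with p hp1 hp2
    have h1 : ∑ i, Real.log (P.cap i - P.load p i) ≤ ∑ i, Real.log (P.cap i) :=
      Finset.sum_le_sum fun i _ => h.log_slack_le hp2 i
    rw [barrier_eq] at hp1
    rw [div_le_iff₀ ht]
    linarith
  have hβ : J.Nonempty → β < 1 := h.lt_one_of_tendsto_atTop (U := (U : Filter (Fin d → ℝ)))
    hν hβ1 hUf hJ hobj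
  let S : Fin k → ℝ := fun i =>
    P.cap i - ∑ j ∈ Jᶜ, P.usage i j * demand (P.c j) (P.α j) P.γ (r j)
  have hslack : ∀ i, Tendsto (fun p => P.cap i - P.load p i) U (𝓝 (S i)) := fun i =>
    (h.tendsto_load hr hJ hJc i).const_sub _
  have hS0 : ∀ i, 0 < S i := fun i =>
    h.limit_slack_pos (U := (U : Filter (Fin d → ℝ))) hν hβ1 ht hU hb (hslack i)
  have hIeq : I = -t * ∑ j ∈ Jᶜ, userValue (P.c j) (P.α j) P.γ ν β (r j) -
      ∑ i, Real.log (S i) := by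
    refine tendsto_nhds_unique hUI ?_
    have h1 := ((h.tendsto_objective hν hβ hr hJ hJc).const_mul (-t)).sub
      (tendsto_finsetSum Finset.univ fun i _ => (hslack i).log (hS0 i).ne')
    exact h1.congr fun p => (P.barrier_eq ν β t p).symm
  rcases J.eq_empty_or_nonempty with rfl | hne
  · have hc : ∀ p j, P.jobCost (Q p) j = r j := fun p j => hQc p j (by simp)
    have hS : ∀ i, P.cap i - P.load (Q q₀) i = S i := fun i => by simp [S, load, jobs, hc]
    refine ⟨Q q₀, ⟨fun j => by rw [hc]; exact hr j, fun i => ?_⟩, fun q hq => ?_⟩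
    · rw [← sub_pos, hS]; exact hS0 i
    · refine le_trans (le_of_eq ?_) (hI q hq)
      rw [hIeq, barrier_eq, objective_eq_sum]
      simp [hS, hc]
  · obtain ⟨q, hq, hlt⟩ := h.exists_strictlyFeasible_lt hν (hβ hne) ht hne hr (fun _ => rfl) hS0
      hQc hQ
    have := hI q hq
    linarith

theorem differentiableAt_barrier (h : P.Admissible) (hν : 0 < ν) {t : ℝ} {p : Fin d → ℝ}
    (hp : p ∈ P.strictlyFeasible) : DifferentiableAt ℝ (P.barrier ν β t) p := by
  have : P.barrier ν β t = _ := funext (P.barrier_eq ν β t)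
  rw [this]
  refine ((h.differentiableAt_objective hν hp.1).const_mul (-t)).sub
    (DifferentiableAt.fun_sum fun i _ => ?_)
  exact ((h.differentiableAt_load hp.1 i).const_sub (P.cap i)).log (sub_pos.2 (hp.2 i)).ne'

theorem strictlyFeasible_mem_nhds (h : P.Admissible) {p : Fin d → ℝ}
    (hp : p ∈ P.strictlyFeasible) : P.strictlyFeasible ∈ 𝓝 p := by
  have h1 : ∀ j, ∀ᶠ q in 𝓝 p, 0 < P.jobCost q j := fun j =>
    (P.continuous_jobCost j).continuousAt.eventually (lt_mem_nhds (hp.1 j))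
  have h2 : ∀ i, ∀ᶠ q in 𝓝 p, P.load q i < P.cap i := fun i =>
    (h.differentiableAt_load hp.1 i).continuousAt.eventually (gt_mem_nhds (hp.2 i))
  exact (eventually_all.2 h1).and (eventually_all.2 h2)

/-- The candidates are the minimizers of the barrier function over the strictly feasible prices. -/
theorem mem_candidates_iff (h : P.Admissible) (hν : 0 < ν) (hβ1 : β ≠ 1) {t : ℝ} (ht : 0 < t)
    {p : Fin d → ℝ} : p ∈ P.candidates ν β t ↔ p ∈ P.strictlyFeasible ∧
      ∀ q ∈ P.strictlyFeasible, P.barrier ν β t p ≤ P.barrier ν β t q := by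
  have hstat : ∀ p ∈ P.strictlyFeasible,
      (∀ q ∈ P.strictlyFeasible, P.barrier ν β t p ≤ P.barrier ν β t q) →
      p ∈ P.stationary ν β t := by
    intro p hp hmin
    have hloc : IsLocalMin (P.barrier ν β t) p := by
      filter_upwards [h.strictlyFeasible_mem_nhds hp] with q hq using hmin q hq
    refine ⟨hp, ?_⟩
    rw [← hloc.fderiv_eq_zero]
    exact (h.differentiableAt_barrier hν hp).hasFDerivAt
  constructor
  · rintro ⟨hp, hle⟩
    -- A global minimizer exists and is itself stationary, so the least stationary value is the
    -- global minimum.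
    obtain ⟨p₀, hp₀, hmin⟩ := h.exists_barrier_minimizer (β := β) hν hβ1 ht
    exact ⟨hp.1, fun q hq => (hle p₀ (hstat p₀ hp₀ hmin)).trans (hmin q hq)⟩
  · rintro ⟨hp, hmin⟩
    exact ⟨hstat p hp hmin, fun q hq => hmin q hq.1⟩

/-! ### Convergence of the algorithm -/

/-- The objective values of the candidates approach the maximum. -/
theorem exists_objective_gt (h : P.Admissible) (hν : 0 < ν) (hβ1 : β ≠ 1) {q : Fin d → ℝ}
    (hq : q ∈ P.maximizers ν β) {ε : ℝ} (hε : 0 < ε) :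
    ∃ T, 0 < T ∧ ∀ t, T ≤ t → ∀ p ∈ P.candidates ν β t,
      P.objective ν β q - ε < P.objective ν β p := by
  have h1 : Tendsto (fun a : ℝ => (1 + a) • q) (𝓝[>] 0) (𝓝 q) := by
    have : Tendsto (fun a : ℝ => (1 + a) • q) (𝓝 0) (𝓝 ((1 + 0 : ℝ) • q)) :=
      Continuous.tendsto (by fun_prop) 0
    rw [add_zero, one_smul] at this
    exact this.mono_left nhdsWithin_le_nhds
  have h2 := ((h.differentiableAt_objective (β := β) hν hq.1.1).continuousAt.tendsto.comp
    h1).eventually (lt_mem_nhds (show P.objective ν β q - ε / 2 < P.objective ν β q by linarith))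
  obtain ⟨a, ha, ha1⟩ := (h2.and (Ioc_mem_nhdsGT (one_pos (α := ℝ)))).exists
  have hs := h.scale_mem_strictlyFeasible hq.1 ha1.1 ha1.2
  set s := (1 + a) • q
  set L := ∑ i, Real.log (P.cap i) - ∑ i, Real.log (P.cap i - P.load s i) with hL
  -- The comparison point `s` loses less than `ε / 2` of the objective, and for these `t` the
  -- logarithmic terms, divided by `t`, account for less than another `ε / 2`.
  refine ⟨|L| / (ε / 2) + 1, by positivity, fun t ht p hp => ?_⟩
  have ht0 : 0 < t := lt_of_lt_of_le (by positivity) ht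
  obtain ⟨hp1, hp2⟩ := (h.mem_candidates_iff hν hβ1 ht0).1 hp
  have h3 := hp2 s hs
  rw [barrier_eq, barrier_eq] at h3
  have h4 : ∑ i, Real.log (P.cap i - P.load p i) ≤ ∑ i, Real.log (P.cap i) :=
    Finset.sum_le_sum fun i _ => h.log_slack_le hp1 i
  have h5 : |L| < t * (ε / 2) := by
    rw [← div_lt_iff₀ (by positivity)]; linarith
  have h6 := le_abs_self L
  have h7 : t * P.objective ν β s < t * (P.objective ν β p + ε / 2) := by linarith
  have h8 := lt_of_mul_lt_mul_left h7 ht0.le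
  simp only [Function.comp_apply] at ha
  linarith

theorem exists_dist_lt (h : P.Admissible) (hν : 0 < ν) (hβ0 : 0 < β) (hβ1 : β ≠ 1)
    {q : Fin d → ℝ} (hq : q ∈ P.maximizers ν β) {ε : ℝ} (hε : 0 < ε) :
    ∃ η, 0 < η ∧ ∀ p ∈ P.feasible, P.objective ν β q - η < P.objective ν β p →
      ∃ q' ∈ P.maximizers ν β, dist p q' < ε := by
  -- This filter encodes feasible prices whose objective value tends to the maximum; unfolding it
  -- yields a uniform `η`.
  have h1 := h.tendsto_infDist hν hβ0 hβ1 hq (p := id)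
    (l := comap (P.objective ν β) (𝓝 (P.objective ν β q)) ⊓ 𝓟 P.feasible)
    (mem_inf_of_right (mem_principal_self _)) (tendsto_comap.mono_left inf_le_left)
  have h2 := h1.eventually (gt_mem_nhds hε)
  rw [eventually_inf_principal, eventually_comap, Metric.eventually_nhds_iff] at h2
  obtain ⟨η, hη, h3⟩ := h2
  refine ⟨η, hη, fun p hp hlt => ?_⟩
  refine (Metric.infDist_lt_iff ⟨q, hq⟩).1 (h3 ?_ p rfl hp)
  rw [Real.dist_eq, abs_lt]
  constructor <;> linarith [hq.2 p hp]

/-- The state of the loop is the initial one, or its prices are a candidate. -/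
theorem candidate_of_reflTransGen {μ tol : ℝ} {p₀ : Fin d → ℝ} {s : ℝ × (Fin d → ℝ)}
    (hs : Relation.ReflTransGen (P.Step ν β μ tol) (1, p₀) s) :
    s.1 = 1 ∨ ∃ t, s.1 = μ * t ∧ s.2 ∈ P.candidates ν β t := by
  cases hs with
  | refl => exact Or.inl rfl
  | tail _ hstep => exact Or.inr ⟨_, hstep.2.2, hstep.2.1⟩

/-- `N` bounds the number of remaining passes: each multiplies `t` by `μ`. -/
theorem acc_step {μ tol : ℝ} (N : ℕ) : ∀ s : ℝ × (Fin d → ℝ), k / tol ≤ s.1 * μ ^ N →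
    Acc (fun s' s => P.Step ν β μ tol s s') s := by
  induction N with
  | zero =>
    intro s hs
    exact ⟨_, fun s' hs' => absurd hs'.1 (not_lt.2 (by simpa using hs))⟩
  | succ N ih =>
    intro s hs
    refine ⟨_, fun s' hs' => ih s' ?_⟩
    rw [hs'.2.2]
    calc (k : ℝ) / tol ≤ s.1 * μ ^ (N + 1) := hs
      _ = μ * s.1 * μ ^ N := by ring

theorem interiorPointConverges (h : P.Admissible) (hν : 0 < ν) (hβ0 : 0 < β) (hβ1 : β ≠ 1)
    {μ : ℝ} (hμ : 1 < μ) : P.InteriorPointConverges ν β μ where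
  exists_maximizer := h.maximizers_nonempty hν hβ0 hβ1
  exists_candidate t ht := by
    obtain ⟨p, hp, hmin⟩ := h.exists_barrier_minimizer (β := β) hν hβ1 ht
    exact ⟨p, (h.mem_candidates_iff hν hβ1 ht).2 ⟨hp, hmin⟩⟩
  terminates tol _ p₀ := by
    obtain ⟨N, hN⟩ := pow_unbounded_of_one_lt ((k : ℝ) / tol) hμ
    exact acc_step N _ (by simpa using hN.le)
  returned ε hε := by
    obtain ⟨q, hq⟩ := h.maximizers_nonempty hν hβ0 hβ1
    obtain ⟨η, hη, hdist⟩ := h.exists_dist_lt hν hβ0 hβ1 hq hε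
    obtain ⟨T, hT, hobj⟩ := h.exists_objective_gt hν hβ1 hq (lt_min hε hη)
    have hk : (0 : ℝ) < k := by exact_mod_cast h.k_pos
    have hμ0 : 0 < μ := by linarith
    -- `tol < k` forces at least one pass. On exit the returned prices belong to the previous
    -- parameter `t' = t / μ`, and `tol < k / (μ * T)` ensures `t' ≥ T`.
    refine ⟨min k (k / (μ * T)), lt_min hk (by positivity), fun tol htol hlt p₀ p hret => ?_⟩
    obtain ⟨t, hreach, hend⟩ := hret
    have h1 : 1 < k / tol := by
      rw [one_lt_div htol]; exact hlt.trans_le (min_le_left _ _)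
    have h2 : μ * T < k / tol := by
      rw [lt_div_iff₀ htol, mul_comm, ← lt_div_iff₀ (by positivity)]
      exact hlt.trans_le (min_le_right _ _)
    rw [not_lt] at hend
    rcases candidate_of_reflTransGen hreach with h3 | ⟨t', h3, hcand⟩
    · simp only at h3; linarith
    · simp only at h3 hcand
      have hTt : T ≤ t' := by
        refine le_of_mul_le_mul_left ?_ hμ0
        linarith
      have hlow := hobj t' hTt p hcand
      have hstr := ((h.mem_candidates_iff hν hβ1 (hT.trans_le hTt)).1 hcand).1
      have hm1 := min_le_left ε η
      have hm2 := min_le_right ε η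
      refine ⟨hstr, hdist p (P.strictlyFeasible_subset hstr) (by linarith), fun q' hq' => ?_⟩
      linarith [hq.2 q' hq'.1]
  iterates p hp := by
    have hpow : ∀ s : ℕ, 0 < μ ^ s := fun s => pow_pos (by linarith) s
    have hfeas : ∀ s, p s ∈ P.feasible := fun s =>
      P.strictlyFeasible_subset ((h.mem_candidates_iff hν hβ1 (hpow s)).1 (hp s)).1
    have hobj : ∀ q ∈ P.maximizers ν β, Tendsto (fun s => P.objective ν β (p s)) atTop
        (𝓝 (P.objective ν β q)) := by
      intro q hq
      rw [Metric.tendsto_nhds]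
      intro ε hε
      obtain ⟨T, -, hT⟩ := h.exists_objective_gt hν hβ1 hq hε
      filter_upwards [(tendsto_pow_atTop_atTop_of_one_lt hμ).eventually_ge_atTop T] with s hs
      have h1 := hT _ hs (p s) (hp s)
      rw [Real.dist_eq, abs_lt]
      constructor <;> linarith [hq.2 (p s) (hfeas s)]
    obtain ⟨q₀, hq₀⟩ := h.maximizers_nonempty hν hβ0 hβ1
    have hinf := h.tendsto_infDist hν hβ0 hβ1 hq₀ (Eventually.of_forall hfeas) (hobj q₀ hq₀)
    refine ⟨hinf, hobj, fun q hq => ?_, fun q hq => ?_⟩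
    · rw [mapClusterPt_iff_ultrafilter] at hq
      obtain ⟨U, hU, hUq⟩ := hq
      have h1 : Tendsto (fun s => Metric.infDist (p s) (P.maximizers ν β)) U
          (𝓝 (Metric.infDist q (P.maximizers ν β))) :=
        ((Metric.continuous_infDist_pt _).tendsto q).comp hUq
      have h2 := tendsto_nhds_unique h1 (hinf.mono_left hU)
      exact ((h.isClosed_maximizers hν).mem_iff_infDist_zero ⟨q₀, hq₀⟩).2 h2
    · rw [hq] at hinf
      rw [tendsto_iff_dist_tendsto_zero]
      simpa using hinf

end Admissible
end PricingProblem

/-! ### Admissibility of the three pricing plans -/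

namespace Datacenter

variable {m n : ℕ} (D : Datacenter m n)

theorem isUser (j : Fin n) : IsUser (D.c j) (D.α j) D.γ :=
  ⟨D.c_pos j, D.α_pos j, D.α_lt_one j, D.one_sub_α_lt_γ j⟩

theorem resourcePricing_admissible (hm : 0 < m) : D.resourcePricing.Admissible where
  k_pos := hm
  isUser := D.isUser
  exists_jobCost_pos := by
    refine ⟨1, fun j => ?_⟩
    obtain ⟨i, hi⟩ := D.exists_R_pos j
    refine Finset.sum_pos' (fun l _ => ?_) ⟨i, Finset.mem_univ i, ?_⟩
    · simpa [resourcePricing] using Real.rpow_nonneg (D.R_nonneg l j) _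
    · simpa [resourcePricing] using Real.rpow_pos_of_pos hi _
  usage_nonneg := D.R_nonneg
  exists_usage_pos := D.exists_R_pos
  cap_pos := D.C_pos

theorem bundlesPerJob_pos {b : Fin m → ℝ} (hb : ∀ i, 0 < b i) (j : Fin n) :
    0 < D.bundlesPerJob b j := by
  obtain ⟨i, hi⟩ := D.exists_R_pos j
  exact (div_pos hi (hb i)).trans_le
    (le_ciSup (f := fun i => D.R i j / b i) (Finite.bddAbove_range _) i)

theorem bundledPricing_admissible (hm : 0 < m) {b : Fin m → ℝ} (hb : ∀ i, 0 < b i) :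
    (D.bundledPricing b).Admissible where
  k_pos := one_pos
  isUser := D.isUser
  exists_jobCost_pos := ⟨1, fun j => by
    simpa [PricingProblem.jobCost, bundledPricing] using
      Real.rpow_pos_of_pos (D.bundlesPerJob_pos hb j) D.γ⟩
  usage_nonneg _ j := (D.bundlesPerJob_pos hb j).le
  exists_usage_pos j := ⟨0, D.bundlesPerJob_pos hb j⟩
  cap_pos _ := by
    have : Nonempty (Fin m) := ⟨⟨0, hm⟩⟩
    obtain ⟨i, hi⟩ := exists_eq_ciInf_of_finite (f := fun i => D.C i / b i)
    change 0 < ⨅ i, D.C i / b i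
    rw [← hi]
    exact div_pos (D.C_pos i) (hb i)

theorem differentiatedPricing_admissible (hm : 0 < m) :
    D.differentiatedPricing.Admissible where
  k_pos := hm
  isUser := D.isUser
  exists_jobCost_pos := ⟨1, fun j => by
    simp [PricingProblem.jobCost, differentiatedPricing]⟩
  usage_nonneg := D.R_nonneg
  exists_usage_pos := D.exists_R_pos
  cap_pos := D.C_pos

end Datacenter

theorem mainTheorem6 {m n : ℕ} (hm : 0 < m) (D : Datacenter m n)
    (b : Fin m → ℝ) (hb : ∀ i, 0 < b i)
    (ν β μ : ℝ) (hν : 0 < ν) (hβ : 0 < β) (hβ1 : β ≠ 1) (hμ : 1 < μ) :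
    D.resourcePricing.InteriorPointConverges ν β μ ∧
    (D.bundledPricing b).InteriorPointConverges ν β μ ∧
    D.differentiatedPricing.InteriorPointConverges ν β μ :=
  ⟨(D.resourcePricing_admissible hm).interiorPointConverges hν hβ hβ1 hμ,
    (D.bundledPricing_admissible hm hb).interiorPointConverges hν hβ hβ1 hμ,
    (D.differentiatedPricing_admissible hm).interiorPointConverges hν hβ hβ1 hμ⟩
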